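/- Let $V$ be a real potential and let $H$ be the self-adjoint discrete Schrödinger operator $[H\psi](n)=\psi(n+1)+\psi(n-1)+V(n)\psi(n)$ on $\ell^2(\mathbb Z)$, or on $\ell^2(\mathbb Z_+)$, $\mathbb Z_+=\{1,2,\dots\}$, with the Dirichlet condition $\psi(0)=0$. For $p,T>0$ put $$\langle |X|^p_{\delta_1}\rangle(T)=\sum_n |n|^p\,a(n,T),\qquad a(n,T)=\frac2T\int_0^\infty e^{-2t/T}\,|\langle e^{-itH}\delta_1,\delta_n\rangle|^2\,dt .$$ Let $F(z)=\langle (H-z)^{-1}\delta_1,\delta_1\rangle$ and, for $\Delta\subseteq\mathbb R$ and $\nu>0$, $I(\Delta,\nu)=\nu\int_\Delta(\operatorname{Im}F(E+i\nu))^2\,dE$; write $\Delta_\nu$ for the $\nu$-neighborhood of $\Delta$. For real sequences $u=(u(n))_{n\ge 0}$ and $L\ge 0$ put $\|u\|_L^2=\sum_{n=1}^{[L]}|u(n)|^2+(L-[L])\,|u([L]+1)|^2$. A solution at energy $E$ is a real $u$ with $u(n+1)+u(n-1)+V(n)u(n)=Eu(n)$ for all $n\ge1$; it is normalized if $|u(0)|^2+|u(1)|^2=1$.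 Let $A\subseteq\mathbb R$ and assume: (a) there are $C,\alpha>0$ such that $\|u\|_L^2\le C L^{2\alpha+1}$ for every $E\in A$, every normalized solution $u$ at energy $E$ and every $L\ge1$; (b) there are $0<k,\gamma<1$ and $L_0\ge1$ such that $\|u\|_L^2\ge(1+\gamma)\|u\|_{kL}^2$ for every $E\in A$, every solution $u$ at energy $E$ and every $L\ge L_0$. Then there are $D,\kappa>0$ and $L_1\ge 1$ such that (c) $\|u\|_L\ge D L^\kappa$ for every $E\in A$, every normalized solution $u$ at energy $E$ and every $L\ge L_1$. Moreover, for all $D,\kappa>0$ and $L_1\ge1$ for which (c) holds there is $T_0>0$ such that for all $T\ge T_0$, with $\varepsilon=1/T$, and all $p>0$ the following bounds hold. If $p\le2\alpha+1$, then $$\langle |X|^p_{\delta_1}\rangle(T)\ \ge\ \frac{\gamma k^p}{12\pi}\Big(\frac{\gamma^2}{5184\,C}\Big)^{\frac{p+2\kappa}{2\alpha+1+2\kappa}}D^{2-\frac{2(p+2\kappa)}{2\alpha+1+2\kappa}}\;T^{\frac{2(p+2\kappa)}{2\alpha+1+2\kappa}}\,I(A_{2\varepsilon},\varepsilon).$$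 If $p>2\alpha+1$, then $$\langle |X|^p_{\delta_1}\rangle(T)\ \ge\ \frac{\gamma k^{2\alpha+1}}{12\pi}\,\frac{\gamma^2}{5184\,C}\;T^2\,I(A_{2\varepsilon},\varepsilon)$$ and $$\langle |X|^p_{\delta_1}\rangle(T)\ \ge\ \frac{\gamma k^p}{12\pi}\Big(\frac{\gamma^2}{5184\,C^2}\Big)^{\frac{p+2\kappa}{2}}D^2\;T^{\frac{p+2\kappa}{2\alpha+1}}\,I(A_{2\varepsilon},\varepsilon).$$ -/

import Mathlib

open scoped ENNReal

noncomputable section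

namespace Schrodinger1D

/-! ### The Hilbert space and the operator -/

/-- The two settings: `ℓ²(ℤ)` and `ℓ²(ℤ₊)`, where `ℤ₊ = {1, 2, …}`. -/
inductive Lattice where
  | wholeLine
  | halfLine

/-- The set of sites of the lattice, as a subset of `ℤ`. -/
def Lattice.sites : Lattice → Set ℤ
  | .wholeLine => Set.univ
  | .halfLine => Set.Ici 1

/-- The site `1`. -/
def Lattice.one : (X : Lattice) → X.sites
  | .wholeLine => ⟨1, Set.mem_univ 1⟩
  | .halfLine => ⟨1, Set.self_mem_Ici⟩

/-- The Hilbert space `ℓ²(ℤ)` or `ℓ²(ℤ₊)`. -/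
abbrev Ell2 (X : Lattice) : Type := lp (fun _ : X.sites => ℂ) 2

/-- The unit vector `δ_n`. -/
def delta (X : Lattice) (n : X.sites) : Ell2 X := lp.single 2 n 1

/-- Extension of a function on the sites by zero to all of `ℤ`; on the half-line this is the
Dirichlet boundary condition `ψ(0) = 0`. -/
def zeroExt {X : Lattice} (ψ : X.sites → ℂ) (n : ℤ) : ℂ :=
  open Classical in if h : n ∈ X.sites then ψ ⟨n, h⟩ else 0

/-- The formal difference expression `ψ(n+1) + ψ(n-1) + V(n) ψ(n)`. On the half-line only the
values `V(n)`, `n ≥ 1`, matter. -/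
def diffExpr (X : Lattice) (V : ℤ → ℝ) (ψ : X.sites → ℂ) (n : X.sites) : ℂ :=
  zeroExt ψ (n + 1) + zeroExt ψ (n - 1) + (V n : ℂ) * ψ n

theorem zeroExt_add {X : Lattice} (ψ φ : X.sites → ℂ) (n : ℤ) :
    zeroExt (ψ + φ) n = zeroExt ψ n + zeroExt φ n := by
  unfold zeroExt; split_ifs <;> simp

theorem zeroExt_smul {X : Lattice} (c : ℂ) (ψ : X.sites → ℂ) (n : ℤ) :
    zeroExt (c • ψ) n = c * zeroExt ψ n := by
  unfold zeroExt; split_ifs <;> simp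

theorem diffExpr_add (X : Lattice) (V : ℤ → ℝ) (ψ φ : X.sites → ℂ) :
    diffExpr X V (ψ + φ) = diffExpr X V ψ + diffExpr X V φ := by
  funext n; simp only [diffExpr, zeroExt_add, Pi.add_apply]; ring

theorem diffExpr_smul (X : Lattice) (V : ℤ → ℝ) (c : ℂ) (ψ : X.sites → ℂ) :
    diffExpr X V (c • ψ) = c • diffExpr X V ψ := by
  funext n; simp only [diffExpr, zeroExt_smul, Pi.smul_apply, smul_eq_mul]; ring

/-- The Schrödinger operator `H` with potential `V`: the self-adjoint operator that acts by
`(Hψ)(n) = ψ(n+1) + ψ(n-1) + V(n) ψ(n)` on its natural domain, which consists of all `ψ ∈ ℓ²` for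
which the right-hand side is in `ℓ²` (all of `ℓ²` if `V` is bounded). -/
def schrodingerOp (X : Lattice) (V : ℤ → ℝ) : Ell2 X →ₗ.[ℂ] Ell2 X where
  domain :=
    { carrier := {ψ | Memℓp (diffExpr X V (ψ : X.sites → ℂ)) 2}
      add_mem' := fun {ψ φ} hψ hφ => by
        simp only [Set.mem_ofPred_eq] at hψ hφ ⊢
        rw [lp.coeFn_add, diffExpr_add]
        exact hψ.add hφ
      zero_mem' := by
        have h : diffExpr X V ((0 : Ell2 X) : X.sites → ℂ) = 0 := by
          funext n
          simp [diffExpr, zeroExt]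
        simp only [Set.mem_ofPred_eq]
        rw [h]
        exact zero_memℓp
      smul_mem' := fun c ψ hψ => by
        simp only [Set.mem_ofPred_eq] at hψ ⊢
        rw [lp.coeFn_smul, diffExpr_smul]
        exact hψ.const_smul c }
  toFun :=
    { toFun := fun ψ => ⟨diffExpr X V ((ψ : Ell2 X) : X.sites → ℂ), ψ.2⟩
      map_add' := fun ψ φ => by
        apply lp.ext
        exact diffExpr_add X V _ _
      map_smul' := fun c ψ => by
        apply lp.ext
        exact diffExpr_smul X V c _ }

/-! ### Dynamics and Borel transform -/

/-- `ψ` solves the Schrödinger equation `ψ' = -i H ψ` with initial state `φ`. -/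
def IsSchrodingerFlow {E : Type*} [NormedAddCommGroup E] [NormedSpace ℂ E]
    (H : E →ₗ.[ℂ] E) (φ : E) (ψ : ℝ → E) : Prop :=
  ψ 0 = φ ∧ ∀ t : ℝ, ∃ h : ψ t ∈ H.domain, HasDerivAt ψ (-Complex.I • H ⟨ψ t, h⟩) t

/-- `e^{-itH} φ` for `φ` in the domain of `H`: the solution of the Schrödinger equation with
initial state `φ` (for self-adjoint `H` it exists and is unique). -/
def schrodingerEvolution {E : Type*} [NormedAddCommGroup E] [NormedSpace ℂ E]
    (H : E →ₗ.[ℂ] E) (φ : E) : ℝ → E :=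
  Classical.epsilon (IsSchrodingerFlow H φ)

/-- The resolvent `(H - z)⁻¹`: the inverse of the map `φ ↦ Hφ - zφ` from the domain of `H` to the
whole space (for self-adjoint `H` and non-real `z` this map is a bijection). -/
def resolventMap {E : Type*} [NormedAddCommGroup E] [NormedSpace ℂ E]
    (H : E →ₗ.[ℂ] E) (z : ℂ) : E → H.domain :=
  Function.invFun (fun φ : H.domain => H φ - z • (φ : E))

/-- `a(n, T) = (2/T) ∫₀^∞ e^{-2t/T} |⟨e^{-itH} δ₁, δ_n⟩|² dt`. -/
def timeAvgProb (X : Lattice) (V : ℤ → ℝ) (n : X.sites) (T : ℝ) : ℝ≥0∞ :=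
  ENNReal.ofReal (2 / T) * ∫⁻ t in Set.Ioi (0 : ℝ), ENNReal.ofReal (Real.exp (-2 * t / T) *
    ‖inner ℂ (delta X n) (schrodingerEvolution (schrodingerOp X V) (delta X X.one) t)‖ ^ 2)

/-- The time-averaged moment `⟨|X|^p_{δ₁}⟩(T) = ∑_n |n|^p a(n, T)`, as an element of `[0, ∞]`. -/
def avgMoment (X : Lattice) (V : ℤ → ℝ) (p T : ℝ) : ℝ≥0∞ :=
  ∑' n : X.sites, ENNReal.ofReal (|((n : ℤ) : ℝ)| ^ p) * timeAvgProb X V n T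

/-- The Borel transform `F(z) = ⟨(H - z)⁻¹ δ₁, δ₁⟩` (the inner product of Mathlib is linear in the
second argument). -/
def borelTransform (X : Lattice) (V : ℤ → ℝ) (z : ℂ) : ℂ :=
  inner ℂ (delta X X.one) (resolventMap (schrodingerOp X V) z (delta X X.one) : Ell2 X)

/-- `I(Δ, ν) = ν ∫_Δ (Im F(E + iν))² dE`. -/
def imIntegral (X : Lattice) (V : ℤ → ℝ) (Δ : Set ℝ) (ν : ℝ) : ℝ≥0∞ :=
  ENNReal.ofReal ν * ∫⁻ E in Δ,
    ENNReal.ofReal ((borelTransform X V ((E : ℂ) + Complex.I * (ν : ℂ))).im ^ 2)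

/-! ### Solutions of the difference equation on the right half-line -/

/-- `u` (given on the sites `0, 1, 2, …`) is a real solution of
`u(n+1) + u(n-1) + V(n) u(n) = E u(n)` for all `n ≥ 1`. For a potential on `ℤ`, each such `u` is the
restriction of exactly one solution on `ℤ`. -/
def IsSolution (V : ℤ → ℝ) (E : ℝ) (u : ℕ → ℝ) : Prop :=
  ∀ n : ℕ, 1 ≤ n → u (n + 1) + u (n - 1) + V n * u n = E * u n

/-- `|u(0)|² + |u(1)|² = 1`. -/
def IsNormalized (u : ℕ → ℝ) : Prop := u 0 ^ 2 + u 1 ^ 2 = 1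

/-- `‖u‖_L² = ∑_{n=1}^{[L]} |u(n)|² + (L - [L]) |u([L]+1)|²`, for `L ≥ 0`. -/
def normSqUpTo (u : ℕ → ℝ) (L : ℝ) : ℝ :=
  ∑ n ∈ Finset.Icc 1 ⌊L⌋₊, u n ^ 2 + (L - (⌊L⌋₊ : ℝ)) * u (⌊L⌋₊ + 1) ^ 2

/-- `‖u‖_L² ≤ C L^{2α+1}` for all `E ∈ A`, all normalized solutions `u` and all `L ≥ 1`. -/
def UpperPowerBound (V : ℤ → ℝ) (A : Set ℝ) (C α : ℝ) : Prop :=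
  ∀ E ∈ A, ∀ u : ℕ → ℝ, IsSolution V E u → IsNormalized u →
    ∀ L : ℝ, 1 ≤ L → normSqUpTo u L ≤ C * L ^ (2 * α + 1)

/-- `‖u‖_L² ≥ (1 + γ) ‖u‖_{kL}²` for all `E ∈ A`, all solutions `u` and all `L ≥ L₀`. -/
def ScalingLowerBound (V : ℤ → ℝ) (A : Set ℝ) (k γ L₀ : ℝ) : Prop :=
  ∀ E ∈ A, ∀ u : ℕ → ℝ, IsSolution V E u →
    ∀ L : ℝ, L₀ ≤ L → (1 + γ) * normSqUpTo u (k * L) ≤ normSqUpTo u L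

/-- `‖u‖_L ≥ D L^κ` for all `E ∈ A`, all normalized solutions `u` and all `L ≥ L₁`. -/
def LowerPowerBound (V : ℤ → ℝ) (A : Set ℝ) (D κ L₁ : ℝ) : Prop :=
  ∀ E ∈ A, ∀ u : ℕ → ℝ, IsSolution V E u → IsNormalized u →
    ∀ L : ℝ, L₁ ≤ L → D * L ^ κ ≤ √(normSqUpTo u L)

end Schrodinger1D

end

open Schrodinger1D

/-! Put `ε = 1/T` and `G_z = (H - z)⁻¹ δ₁`. The resolvent is `i` times the Laplace transform of the
flow, so Plancherel on the line `Im z = ε` gives `a(n,T) = (ε/π) ∫ |G_{E+iε}(n)|² dE`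
(`timeAvgProb_eq`). Since `F(z) = G_z(1)` and `|F| ≥ |Im F|`, it suffices to bound `∑ n^p |G_z(n)|²`
below by a multiple of `|G_z(1)|²` at each energy within `2ε` of `A`
(`ofReal_mul_imIntegral_le_avgMoment`).

Fix such an energy and `E₀ ∈ A` near it. On the sites `n ≥ 1`, after a correction at site `0`, `G_z`
solves the homogeneous equation at `z`. Compare it with the solution `φ` at `E₀` having the same
values at `0` and `1`. Variation of parameters and Cauchy–Schwarz give `‖G - φ‖_L² ≤ 2 |z - E₀|²
det_L ‖G‖_L²`, where `det_L` is the Gram determinant of the two basic solutions at `E₀`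
(`weightedSum_norm_sub_sq_le`). The scale `L` is chosen so that `det_L = (γT/72)²`, which makes the
error a small multiple of `γ²`. By (b) a fixed fraction of `‖φ‖_L²` lies between `kL` and `L`, hence
so does enough of `G` (`annulus_sum_ge`).

The scale `L` is not explicit. What is known is `L ≥ l` with `C l^{2α+1} = γT/72`, and two lower
bounds for `‖u‖_L²` over normalized `u`: `D² L^{2κ}` from (c), and `det_L / (C L^{2α+1})` from (a),
because `det_L ≤ ‖u‖_L² ‖u^⊥‖_L²`. After multiplication by `L^p` the first grows with `L`, and for
`p ≤ 2α+1` the second does not, so their maximum is at least the value where they cross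
(`interpolate_le_max`). For larger `p` the two bounds of the theorem use the second and the first
separately.

Statement (c) itself follows by iterating (b) (`exists_lowerPowerBound`). -/

namespace Schrodinger1D

open MeasureTheory FourierTransform Filter Topology ComplexConjugate

/-! ### Plancherel's identity for the Laplace transform -/

/-- On `L¹ ∩ L²` the `L²` Fourier transform is given by the Fourier integral. -/
theorem fourier_toLp_ae_eq {f : ℝ → ℂ} (h1 : Integrable f) (h2 : MemLp f 2) :
    (𝓕 (h2.toLp f) : Lp ℂ 2 (volume : Measure ℝ)) =ᵐ[volume] 𝓕 f := by
  have hcont : Continuous (𝓕 f) := by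
    exact VectorFourier.fourierIntegral_continuous Real.continuous_fourierChar (by fun_prop) h1
  apply ae_eq_of_integral_contDiff_smul_eq
  · exact (Lp.memLp _).locallyIntegrable one_le_two
  · exact hcont.locallyIntegrable
  · intro g hg hgs
    have hg₁ : HasCompactSupport (Complex.ofRealCLM ∘ g) := hgs.comp_left rfl
    have hg₂ : ContDiff ℝ (⊤ : ℕ∞) (Complex.ofRealCLM ∘ g) :=
      Complex.ofRealCLM.contDiff.comp hg
    set φ := hg₁.toSchwartzMap hg₂ with hφ
    -- The two transforms are compared as distributions: the Fourier transform moves onto the test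
    -- function, by definition on the `Lp` side and by Fubini on the integral side.
    have key := congrArg (fun T => T φ) (Lp.fourier_toTemperedDistribution_eq (h2.toLp f))
    simp only [TemperedDistribution.fourier_apply, Lp.toTemperedDistribution_apply] at key
    have e1 : ∫ x, g x • (𝓕 (h2.toLp f) : Lp ℂ 2 (volume : Measure ℝ)) x
        = ∫ x, φ x • (𝓕 (h2.toLp f) : Lp ℂ 2 (volume : Measure ℝ)) x := by
      refine integral_congr_ae (Filter.Eventually.of_forall fun x => ?_)
      simp [hφ]
    have e2 : ∫ x, g x • 𝓕 f x = ∫ x, φ x • 𝓕 f x := by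
      refine integral_congr_ae (Filter.Eventually.of_forall fun x => ?_)
      simp [hφ]
    rw [e1, e2, ← key]
    have e3 : ∫ x, (𝓕 φ) x • (h2.toLp f : Lp ℂ 2 (volume : Measure ℝ)) x
        = ∫ x, (𝓕 φ) x • f x := by
      refine integral_congr_ae ?_
      filter_upwards [h2.coeFn_toLp] with x hx
      rw [hx]
    rw [e3]
    have := VectorFourier.integral_fourierIntegral_smul_eq_flip (L := innerₗ ℝ)
      (μ := volume) (ν := volume) Real.continuous_fourierChar (by fun_prop)
      (φ.integrable) h1
    simpa [SchwartzMap.fourier_coe] using! this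

theorem lintegral_fourier_sq {f : ℝ → ℂ} (h1 : Integrable f) (h2 : MemLp f 2) :
    ∫⁻ ξ, ‖𝓕 f ξ‖ₑ ^ 2 = ∫⁻ t, ‖f t‖ₑ ^ 2 := by
  have h := Lp.norm_fourier_eq (h2.toLp f)
  have h' : eLpNorm (𝓕 f) 2 volume = eLpNorm f 2 volume := by
    rw [← eLpNorm_congr_ae (fourier_toLp_ae_eq h1 h2), ← eLpNorm_congr_ae h2.coeFn_toLp]
    rw [Lp.norm_def, Lp.norm_def] at h
    exact (ENNReal.toReal_eq_toReal_iff' (Lp.eLpNorm_ne_top _) (Lp.eLpNorm_ne_top _)).1 h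
  have e : ∀ g : ℝ → ℂ, ∫⁻ t, ‖g t‖ₑ ^ 2 = eLpNorm g 2 volume ^ 2 := by
    intro g
    have := eLpNorm_nnreal_pow_eq_lintegral (f := g) (μ := volume) (p := 2) two_ne_zero
    simpa using this.symm
  rw [e, e, h']

/-- The damped function `e^{-εt} ψ(t)` on the half-line `t > 0`. -/
noncomputable def dampedPart (ψ : ℝ → ℂ) (ε : ℝ) : ℝ → ℂ :=
  (Set.Ioi (0 : ℝ)).indicator fun t => Complex.exp (-(ε : ℂ) * t) * ψ t

theorem norm_exp_neg_mul (ε t : ℝ) : ‖Complex.exp (-(ε : ℂ) * t)‖ = Real.exp (-ε * t) := by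
  rw [Complex.norm_exp]; simp

theorem integrable_dampedPart {ψ : ℝ → ℂ} (hc : Continuous ψ) (hb : ∀ t, ‖ψ t‖ ≤ 1) {ε : ℝ}
    (hε : 0 < ε) : Integrable (dampedPart ψ ε) := by
  rw [dampedPart, integrable_indicator_iff measurableSet_Ioi]
  refine (exp_neg_integrableOn_Ioi 0 hε).mono' (by fun_prop) (ae_of_all _ fun t => ?_)
  rw [norm_mul, norm_exp_neg_mul]
  exact mul_le_of_le_one_right (Real.exp_nonneg _) (hb t)

theorem memLp_two_dampedPart {ψ : ℝ → ℂ} (hc : Continuous ψ) (hb : ∀ t, ‖ψ t‖ ≤ 1) {ε : ℝ}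
    (hε : 0 < ε) : MemLp (dampedPart ψ ε) 2 := by
  rw [memLp_two_iff_integrable_sq_norm (integrable_dampedPart hc hb hε).aestronglyMeasurable]
  refine (integrable_dampedPart hc hb hε).norm.mono'
    ((integrable_dampedPart hc hb hε).aestronglyMeasurable.norm.pow 2) (ae_of_all _ fun t => ?_)
  have h1 : ‖dampedPart ψ ε t‖ ≤ 1 := by
    rw [dampedPart]
    by_cases ht : t ∈ Set.Ioi (0 : ℝ)
    · rw [Set.indicator_of_mem ht, norm_mul, norm_exp_neg_mul]
      refine mul_le_one₀ ?_ (norm_nonneg _) (hb t)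
      rw [Real.exp_le_one_iff]
      have : 0 < t := ht
      nlinarith
    · rw [Set.indicator_of_notMem ht]; simp
  rw [norm_pow, norm_norm]
  nlinarith [norm_nonneg (dampedPart ψ ε t)]

theorem integral_laplace_eq_fourier (ψ : ℝ → ℂ) (ε E : ℝ) :
    ∫ t in Set.Ioi (0 : ℝ), Complex.exp (Complex.I * (E + Complex.I * ε) * t) * ψ t
      = 𝓕 (dampedPart ψ ε) (-(2 * Real.pi)⁻¹ * E) := by
  rw [Real.fourier_real_eq_integral_exp_smul, ← integral_indicator measurableSet_Ioi]
  congr 1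
  funext t
  rw [dampedPart]
  by_cases ht : t ∈ Set.Ioi (0 : ℝ)
  · rw [Set.indicator_of_mem ht, Set.indicator_of_mem ht, smul_eq_mul, ← mul_assoc,
      ← Complex.exp_add]
    congr 2
    have hpi : (Real.pi : ℂ) ≠ 0 := by exact_mod_cast Real.pi_ne_zero
    push_cast
    field_simp
    linear_combination (ε : ℂ) * t * Complex.I_sq
  · rw [Set.indicator_of_notMem ht, Set.indicator_of_notMem ht, smul_zero]

theorem continuous_integral_laplace {ψ : ℝ → ℂ} (hc : Continuous ψ) (hb : ∀ t, ‖ψ t‖ ≤ 1)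
    {ε : ℝ} (hε : 0 < ε) : Continuous fun E : ℝ =>
      ∫ t in Set.Ioi (0 : ℝ), Complex.exp (Complex.I * (E + Complex.I * ε) * t) * ψ t := by
  simp_rw [integral_laplace_eq_fourier]
  have : Continuous (𝓕 (dampedPart ψ ε)) :=
    VectorFourier.fourierIntegral_continuous Real.continuous_fourierChar (by fun_prop)
      (integrable_dampedPart hc hb hε)
  exact this.comp (by fun_prop)

/-- Plancherel's identity for the Laplace transform on a horizontal line. -/
theorem lintegral_laplace_sq {ψ : ℝ → ℂ} (hc : Continuous ψ) (hb : ∀ t, ‖ψ t‖ ≤ 1) {ε : ℝ}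
    (hε : 0 < ε) :
    ∫⁻ E : ℝ, ‖∫ t in Set.Ioi (0 : ℝ),
        Complex.exp (Complex.I * (E + Complex.I * ε) * t) * ψ t‖ₑ ^ 2
      = ENNReal.ofReal (2 * Real.pi) *
        ∫⁻ t in Set.Ioi (0 : ℝ), ENNReal.ofReal (Real.exp (-2 * ε * t) * ‖ψ t‖ ^ 2) := by
  have hpi := Real.pi_pos
  have hcF : Continuous (𝓕 (dampedPart ψ ε)) :=
    VectorFourier.fourierIntegral_continuous Real.continuous_fourierChar (by fun_prop)
      (integrable_dampedPart hc hb hε)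
  simp_rw [integral_laplace_eq_fourier]
  have hne : (-(2 * Real.pi)⁻¹ : ℝ) ≠ 0 := by
    have : (2 * Real.pi)⁻¹ ≠ 0 := by positivity
    exact neg_ne_zero.2 this
  have hs := lintegral_map (μ := (volume : Measure ℝ)) (f := fun ξ => ‖𝓕 (dampedPart ψ ε) ξ‖ₑ ^ 2)
    (g := fun E : ℝ => -(2 * Real.pi)⁻¹ * E) (by fun_prop) (by fun_prop)
  rw [← hs, Real.map_volume_mul_left hne, lintegral_smul_measure,
    lintegral_fourier_sq (integrable_dampedPart hc hb hε) (memLp_two_dampedPart hc hb hε)]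
  rw [smul_eq_mul]
  congr 1
  · congr 1
    rw [inv_neg, inv_inv, abs_neg, abs_of_pos (by positivity)]
  · rw [← lintegral_indicator measurableSet_Ioi]
    congr 1
    funext t
    rw [dampedPart]
    by_cases ht : t ∈ Set.Ioi (0 : ℝ)
    · rw [Set.indicator_of_mem ht, Set.indicator_of_mem ht, ← ofReal_norm, norm_mul,
        norm_exp_neg_mul, ← ENNReal.ofReal_pow (by positivity), mul_pow, ← Real.exp_nat_mul]
      congr 3
      push_cast; ring
    · rw [Set.indicator_of_notMem ht, Set.indicator_of_notMem ht]; simp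

/-! ### Square-summable functions and symmetry of the operator -/

theorem memℓp_two_iff {ι : Type*} {f : ι → ℂ} : Memℓp f 2 ↔ Summable fun i => ‖f i‖ ^ 2 := by
  rw [memℓp_gen_iff (by norm_num)]; simp

theorem zeroExt_coe {X : Lattice} (ψ : X.sites → ℂ) (n : X.sites) : zeroExt ψ n = ψ n := by
  simp [zeroExt]

theorem zeroExt_of_notMem {X : Lattice} (ψ : X.sites → ℂ) {n : ℤ} (hn : n ∉ X.sites) :
    zeroExt ψ n = 0 := by
  simp [zeroExt, hn]

theorem summable_zeroExt {X : Lattice} (ψ : Ell2 X) : Summable fun n : ℤ => ‖zeroExt ψ n‖ ^ 2 := by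
  rw [← (Subtype.val_injective (p := (· ∈ X.sites))).summable_iff]
  · simpa only [Function.comp_def, zeroExt_coe] using memℓp_two_iff.1 (lp.memℓp ψ)
  · intro n hn
    have hn' : n ∉ X.sites := fun h => hn ⟨⟨n, h⟩, rfl⟩
    simp [zeroExt_of_notMem _ hn']

theorem summable_mul_of_summable_sq {ι : Type*} {f g : ι → ℂ} (hf : Summable fun i => ‖f i‖ ^ 2)
    (hg : Summable fun i => ‖g i‖ ^ 2) : Summable fun i => f i * g i := by
  refine Summable.of_norm_bounded (hf.add hg) fun i => ?_
  rw [norm_mul]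
  nlinarith [sq_nonneg (‖f i‖ - ‖g i‖), norm_nonneg (f i), norm_nonneg (g i)]

theorem summable_sq_comp_add {f : ℤ → ℂ} (hf : Summable fun i => ‖f i‖ ^ 2) (m : ℤ) :
    Summable fun i => ‖f (i + m)‖ ^ 2 :=
  hf.comp_injective (i := fun i : ℤ => i + m) (add_left_injective m)

/-- Green's identity on the maximal domain. -/
theorem inner_diffExpr_symm (X : Lattice) (V : ℤ → ℝ) (ψ φ ψ' φ' : Ell2 X)
    (hψ : (ψ' : X.sites → ℂ) = diffExpr X V ψ) (hφ : (φ' : X.sites → ℂ) = diffExpr X V φ) :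
    inner ℂ ψ' φ = inner ℂ ψ φ' := by
  set a : ℤ → ℂ := zeroExt ψ with ha
  set b : ℤ → ℂ := zeroExt φ with hb
  set W : ℤ → ℂ := fun n => conj (a (n + 1)) * b n - conj (a n) * b (n + 1) with hW
  have sa : Summable fun n => ‖conj (a n)‖ ^ 2 := by simpa using summable_zeroExt ψ
  have sb : Summable fun n => ‖b n‖ ^ 2 := summable_zeroExt φ
  have sa' : Summable fun n => ‖conj (a (n + 1))‖ ^ 2 :=
    summable_sq_comp_add (f := fun n => conj (a n)) sa 1
  have s1 : Summable fun n => conj (a (n + 1)) * b n := summable_mul_of_summable_sq sa' sb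
  have s2 : Summable fun n => conj (a n) * b (n + 1) :=
    summable_mul_of_summable_sq sa (summable_sq_comp_add sb 1)
  have sW : Summable W := s1.sub s2
  have sW' : Summable fun n => W (n - 1) :=
    sW.comp_injective (i := fun n : ℤ => n - 1) (sub_left_injective)
  have hsum : ∑' n : ℤ, (W n - W (n - 1)) = 0 := by
    have h1 : ∑' n : ℤ, W (n - 1) = ∑' n, W n := (Equiv.subRight (1 : ℤ)).tsum_eq W
    rw [sW.tsum_sub sW', h1, sub_self]
  have hpt : ∀ n : X.sites, inner ℂ (ψ' n) (φ n) - inner ℂ (ψ n) (φ' n)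
      = W n - W ((n : ℤ) - 1) := by
    intro n
    rw [hψ, hφ]
    simp only [diffExpr, RCLike.inner_apply, hW, sub_add_cancel, map_add, map_mul,
      Complex.conj_ofReal, ← zeroExt_coe (ψ : X.sites → ℂ) n, ← zeroExt_coe (φ : X.sites → ℂ) n,
      ← ha, ← hb]
    ring
  -- Outside the lattice both sequences vanish at `n`, so extending the sum to all of `ℤ` adds no
  -- boundary term. This is where the Dirichlet condition enters; the sum over `ℤ` telescopes to
  -- zero.
  have hsupp : Function.support (fun n : ℤ => W n - W (n - 1)) ⊆ X.sites := by
    intro n hn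
    by_contra h
    apply hn
    have h1 : a n = 0 := zeroExt_of_notMem _ h
    have h2 : b n = 0 := zeroExt_of_notMem _ h
    simp [hW, h1, h2]
  have h1 := (lp.hasSum_inner (𝕜 := ℂ) ψ' φ).sub (lp.hasSum_inner (𝕜 := ℂ) ψ φ')
  rw [← sub_eq_zero, ← h1.tsum_eq, ← hsum]
  calc _ = ∑' n : X.sites, (fun n : ℤ => W n - W (n - 1)) n := tsum_congr hpt
    _ = _ := tsum_subtype_eq_of_support_subset (f := fun n : ℤ => W n - W (n - 1)) hsupp

theorem schrodingerOp_symm (X : Lattice) (V : ℤ → ℝ) (ψ φ : (schrodingerOp X V).domain) :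
    inner ℂ (schrodingerOp X V ψ) (φ : Ell2 X) = inner ℂ (ψ : Ell2 X) (schrodingerOp X V φ) :=
  inner_diffExpr_symm X V ψ φ (schrodingerOp X V ψ) (schrodingerOp X V φ) rfl rfl

/-! ### Schrödinger flows of symmetric and of bounded self-adjoint operators -/

section Flow

variable {E : Type*} [NormedAddCommGroup E] [InnerProductSpace ℂ E]

/-- The two terms in the derivative of `⟨ψ, ψ⟩` cancel by symmetry. -/
theorem IsSchrodingerFlow.norm_eq {H : E →ₗ.[ℂ] E}
    (hH : ∀ ψ φ : H.domain, inner ℂ (H ψ) (φ : E) = inner ℂ (ψ : E) (H φ))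
    {φ : E} {ψ : ℝ → E} (h : IsSchrodingerFlow H φ ψ) (t : ℝ) : ‖ψ t‖ = ‖φ‖ := by
  have hd : ∀ s, HasDerivAt (fun s => inner ℂ (ψ s) (ψ s)) 0 s := by
    intro s
    obtain ⟨hs, hds⟩ := h.2 s
    have := hds.inner ℂ hds
    convert! this using 1
    rw [inner_smul_left, inner_smul_right, hH ⟨ψ s, hs⟩ ⟨ψ s, hs⟩]
    simp
  have hc := is_const_of_deriv_eq_zero (fun s => (hd s).differentiableAt)
    (fun s => (hd s).deriv) t 0
  simp only [h.1, inner_self_eq_norm_sq_to_K] at hc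
  have h2 : ‖ψ t‖ ^ 2 = ‖φ‖ ^ 2 := by exact_mod_cast hc
  exact (pow_left_inj₀ (norm_nonneg _) (norm_nonneg _) two_ne_zero).1 h2

/-- Unlike differentiability, a quadratic Taylor bound with a fixed constant survives coordinatewise
limits; this is how the flow equation passes from truncated potentials to `V`. -/
theorem hasDerivAt_of_norm_sub_le_sq {F : Type*} [NormedAddCommGroup F] [NormedSpace ℝ F]
    {ψ : ℝ → F} {d : F} {s K : ℝ}
    (h : ∀ t, ‖ψ t - ψ s - (t - s) • d‖ ≤ K * (t - s) ^ 2) : HasDerivAt ψ d s := by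
  rw [hasDerivAt_iff_isLittleO]
  have h1 : (fun t => ψ t - ψ s - (t - s) • d) =O[𝓝 s] fun t => (t - s) ^ 2 := by
    refine Asymptotics.IsBigO.of_bound K (Eventually.of_forall fun t => ?_)
    simpa using h t
  refine h1.trans_isLittleO ?_
  have h2 : Tendsto (fun t : ℝ => t - s) (𝓝 s) (𝓝 0) := by
    have : Tendsto (fun t : ℝ => t - s) (𝓝 s) (𝓝 (s - s)) := by
      exact (continuous_id.sub continuous_const).tendsto s
    simpa using this
  simpa [pow_two] using! ((Asymptotics.isLittleO_one_iff ℝ).2 h2).mul_isBigO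
    (Asymptotics.isBigO_refl (fun t : ℝ => t - s) (𝓝 s))

theorem norm_sub_smul_le_of_hasDerivAt {F : Type*} [NormedAddCommGroup F] [NormedSpace ℝ F]
    {u u' : ℝ → F} {K : ℝ} (hu : ∀ t, HasDerivAt u (u' t) t)
    (hu' : ∀ s t, ‖u' t - u' s‖ ≤ K * |t - s|) (s t : ℝ) :
    ‖u t - u s - (t - s) • u' s‖ ≤ K * (t - s) ^ 2 := by
  have hd : ∀ τ, HasDerivAt (fun τ => u τ - (τ - s) • u' s) (u' τ - u' s) τ := by
    intro τ
    have h2 : HasDerivAt (fun τ : ℝ => (τ - s) • u' s) ((1 : ℝ) • u' s) τ :=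
      ((hasDerivAt_id τ).sub_const s).smul_const (u' s)
    simpa using! (hu τ).sub h2
  have hK : 0 ≤ K := by
    have := (norm_nonneg _).trans (hu' 0 1)
    simpa using this
  have := (convex_uIcc s t).norm_image_sub_le_of_norm_hasDerivWithin_le
    (f := fun τ => u τ - (τ - s) • u' s) (f' := fun τ => u' τ - u' s) (C := K * |t - s|)
    (fun τ _ => (hd τ).hasDerivWithinAt)
    (fun τ hτ => (hu' s τ).trans 
      (mul_le_mul_of_nonneg_left (Set.abs_sub_left_of_mem_uIcc hτ) hK)) Set.left_mem_uIcc Set.right_mem_uIcc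
  simp only [sub_self, zero_smul, sub_zero] at this
  rw [Real.norm_eq_abs, mul_assoc, abs_mul_abs_self, ← pow_two] at this
  convert! this using 2
  abel

/-- Here `u t = exp(-itA) v`. The exponential is unitary and commutes with `A`, so every bound
involves only `v`, `A v` and `A (A v)`, which leaves room for uniformity in a family of operators.
-/
theorem exists_flow_of_selfAdjoint [CompleteSpace E] (A : selfAdjoint (E →L[ℂ] E)) (v : E) :
    ∃ u : ℝ → E, u 0 = v ∧ (∀ t, ‖u t‖ = ‖v‖) ∧ (∀ t, ‖(A : E →L[ℂ] E) (u t)‖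
      = ‖(A : E →L[ℂ] E) v‖) ∧ ∀ s t, ‖u t - u s - (t - s) • (-Complex.I • (A : E →L[ℂ] E) (u s))‖
        ≤ ‖(A : E →L[ℂ] E) ((A : E →L[ℂ] E) v)‖ * (t - s) ^ 2 := by
  set B : E →L[ℂ] E := (A : E →L[ℂ] E) with hB
  set U : ℝ → E →L[ℂ] E := fun t => NormedSpace.exp (t • (-Complex.I • B)) with hU
  have hUmem : ∀ t w, ‖U t w‖ = ‖w‖ := by
    intro t w
    have h1 : U t = ((selfAdjoint.expUnitary ((-t) • A) : unitary (E →L[ℂ] E)) : E →L[ℂ] E) := by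
      rw [selfAdjoint.expUnitary_coe, hU]
      simp only [selfAdjoint.val_smul, ← hB]
      rw [smul_comm, neg_smul, neg_smul, smul_neg]
    rw [h1]
    exact Unitary.norm_map _ w
  have hder : ∀ w t, HasDerivAt (fun τ => U τ w) (U t (-Complex.I • B w)) t := by
    intro w t
    have h1 := hasDerivAt_exp_smul_const (-Complex.I • B) t
    exact ((ContinuousLinearMap.apply ℂ E w).restrictScalars ℝ).hasFDerivAt.comp_hasDerivAt t h1
  have hcomm : ∀ t w, B (U t w) = U t (B w) := by
    intro t w
    have : Commute B (U t) :=
      (((Commute.refl B).smul_right (-Complex.I)).smul_right t).exp_right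
    exact congrArg (fun T : E →L[ℂ] E => T w) this.eq
  have hbd : ∀ w, ∀ s t, ‖U t w - U s w‖ ≤ ‖B w‖ * |t - s| := by
    intro w s t
    have := convex_univ.norm_image_sub_le_of_norm_hasDerivWithin_le
      (f := fun τ => U τ w) (C := ‖B w‖)
      (fun τ _ => (hder w τ).hasDerivWithinAt)
      (fun τ _ => by rw [hUmem, norm_smul]; simp) (Set.mem_univ s) (Set.mem_univ t)
    simpa using this
  refine ⟨fun t => U t v, ?_, fun t => hUmem t v, fun t => ?_, ?_⟩
  · simp [hU]
  · rw [hcomm, hUmem]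
  · refine norm_sub_smul_le_of_hasDerivAt (u := fun t => U t v)
      (u' := fun t => -Complex.I • B (U t v)) ?_ ?_
    · intro t
      have := hder v t
      rwa [map_smul, ← hcomm] at this
    · intro s t
      rw [← smul_sub, norm_smul, hcomm, hcomm]
      simpa using hbd (B v) s t

end Flow

/-! ### Existence of the Schrödinger flow -/

/-- The potential `V` restricted to the sites `|n| ≤ N`. -/
noncomputable def cutoff (V : ℤ → ℝ) (N : ℕ) (n : ℤ) : ℝ := if |n| ≤ N then V n else 0

theorem memℓp_diffExpr_cutoff (X : Lattice) (V : ℤ → ℝ) (N : ℕ) (ψ : Ell2 X) :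
    Memℓp (diffExpr X (cutoff V N) (ψ : X.sites → ℂ)) 2 := by
  have hs := summable_zeroExt ψ
  have hinj : Function.Injective (fun n : X.sites => (n : ℤ)) := Subtype.val_injective
  have m1 : Memℓp (fun n : X.sites => zeroExt (ψ : X.sites → ℂ) ((n : ℤ) + 1)) 2 :=
    memℓp_two_iff.2 ((summable_sq_comp_add hs 1).comp_injective hinj)
  have m2 : Memℓp (fun n : X.sites => zeroExt (ψ : X.sites → ℂ) ((n : ℤ) - 1)) 2 :=
    memℓp_two_iff.2 ((summable_sq_comp_add hs (-1)).comp_injective hinj)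
  have m3 : Memℓp (fun n : X.sites => (cutoff V N n : ℂ) * (ψ : X.sites → ℂ) n) 2 := by
    rw [memℓp_two_iff]
    refine summable_of_hasFiniteSupport
      (Set.Finite.subset ((Set.finite_Icc (-(N : ℤ)) N).preimage hinj.injOn) fun n hn => ?_)
    by_contra h
    apply hn
    have : ¬ |(n : ℤ)| ≤ N := by rwa [abs_le]
    simp [cutoff, this]
  exact (m1.add m2).add m3

/-- The bounded Schrödinger operator with truncated potential. -/
noncomputable def cutoffOp (X : Lattice) (V : ℤ → ℝ) (N : ℕ) : Ell2 X →ₗ[ℂ] Ell2 X where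
  toFun ψ := ⟨diffExpr X (cutoff V N) ψ, memℓp_diffExpr_cutoff X V N ψ⟩
  map_add' _ _ := lp.ext (diffExpr_add X _ _ _)
  map_smul' c _ := lp.ext (diffExpr_smul X _ c _)

theorem cutoffOp_isSymmetric (X : Lattice) (V : ℤ → ℝ) (N : ℕ) : (cutoffOp X V N).IsSymmetric :=
  fun ψ φ => inner_diffExpr_symm X (cutoff V N) ψ φ (cutoffOp X V N ψ) (cutoffOp X V N φ) rfl rfl

theorem cutoffOp_apply (X : Lattice) (V : ℤ → ℝ) (N : ℕ) (ψ : Ell2 X) (n : X.sites) :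
    cutoffOp X V N ψ n = diffExpr X (cutoff V N) ψ n := rfl

theorem cutoffOp_eq_of_support {X : Lattice} (V : ℤ → ℝ) {M N : ℕ} (hMN : M ≤ N) {ψ : Ell2 X}
    (hψ : ∀ n : X.sites, (M : ℤ) < |(n : ℤ)| → ψ n = 0) :
    cutoffOp X V N ψ = cutoffOp X V M ψ := by
  apply lp.ext
  funext n
  simp only [cutoffOp_apply, diffExpr]
  rcases le_or_gt |(n : ℤ)| M with h | h
  · have h' : |(n : ℤ)| ≤ N := h.trans (by exact_mod_cast hMN)
    simp [cutoff, h, h']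
  · simp [hψ n h]

theorem delta_apply (X : Lattice) (n m : X.sites) : delta X n m = if m = n then 1 else 0 := by
  classical
  rw [delta, lp.coeFn_single]
  simp [Pi.single_apply]

theorem Lattice.coe_one (X : Lattice) : ((X.one : X.sites) : ℤ) = 1 := by
  cases X <;> rfl

theorem delta_one_eq_zero (X : Lattice) {n : X.sites} (h : (n : ℤ) ≠ 1) :
    delta X X.one n = 0 := by
  rw [delta_apply, if_neg]
  rintro rfl
  exact h X.coe_one

theorem zeroExt_delta_one_eq_zero (X : Lattice) {n : ℤ} (h : n ≠ 1) :
    zeroExt (delta X X.one : X.sites → ℂ) n = 0 := by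
  by_cases hn : n ∈ X.sites
  · rw [show n = ((⟨n, hn⟩ : X.sites) : ℤ) from rfl, zeroExt_coe]
    exact delta_one_eq_zero X h
  · exact zeroExt_of_notMem _ hn

theorem cutoffOp_delta_support (X : Lattice) (V : ℤ → ℝ) (N : ℕ) (n : X.sites)
    (hn : 2 < |(n : ℤ)|) : cutoffOp X V N (delta X X.one) n = 0 := by
  rw [cutoffOp_apply, diffExpr, zeroExt_delta_one_eq_zero, zeroExt_delta_one_eq_zero,
    delta_one_eq_zero]
  · simp
  · rintro h; rw [h] at hn; norm_num at hn
  · intro h; rw [show (n : ℤ) = 2 by omega] at hn; norm_num at hn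
  · intro h; rw [show (n : ℤ) = 0 by omega] at hn; norm_num at hn

theorem tendsto_zeroExt {X : Lattice} {ι : Type*} {l : Filter ι} {F : ι → X.sites → ℂ}
    {f : X.sites → ℂ} (h : ∀ n, Tendsto (fun i => F i n) l (𝓝 (f n))) (m : ℤ) :
    Tendsto (fun i => zeroExt (F i) m) l (𝓝 (zeroExt f m)) := by
  by_cases hm : m ∈ X.sites
  · simpa only [zeroExt, hm, dif_pos] using h ⟨m, hm⟩
  · simpa only [zeroExt_of_notMem _ hm] using tendsto_const_nhds

theorem tendsto_diffExpr_cutoff {X : Lattice} (V : ℤ → ℝ) {l : Filter ℕ} (hl : l ≤ atTop)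
    {F : ℕ → X.sites → ℂ} {f : X.sites → ℂ} (h : ∀ n, Tendsto (fun i => F i n) l (𝓝 (f n)))
    (n : X.sites) :
    Tendsto (fun i => diffExpr X (cutoff V (i + 2)) (F i) n) l (𝓝 (diffExpr X V f n)) := by
  have hV : Tendsto (fun i : ℕ => (cutoff V (i + 2) n : ℂ)) l (𝓝 (V n : ℂ)) := by
    refine Tendsto.mono_left ?_ hl
    refine tendsto_const_nhds.congr' ?_
    filter_upwards [eventually_ge_atTop (n : ℤ).natAbs] with i hi
    have : |(n : ℤ)| ≤ ((i + 2 : ℕ) : ℤ) := by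
      rw [Int.abs_eq_natAbs]; omega
    rw [cutoff, if_pos this]
  exact ((tendsto_zeroExt h _).add (tendsto_zeroExt h _)).add (hV.mul (h n))

/-- Truncating the potential gives bounded self-adjoint operators; their flows are uniformly bounded
and have a coordinatewise limit, which inherits both the domain condition and the equation.
Uniqueness of the flow is never needed: the later identities hold for any flow. -/
theorem exists_schrodingerFlow (X : Lattice) (V : ℤ → ℝ) :
    ∃ ψ, IsSchrodingerFlow (schrodingerOp X V) (delta X X.one) ψ := by
  set v : Ell2 X := delta X X.one with hv
  have hflow := fun N : ℕ => exists_flow_of_selfAdjoint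
    (cutoffOp_isSymmetric X V (N + 2)).toSelfAdjoint v
  have hcoe : ∀ N (w : Ell2 X), (((cutoffOp_isSymmetric X V N).toSelfAdjoint :
    selfAdjoint (Ell2 X →L[ℂ] Ell2 X)) : Ell2 X →L[ℂ] Ell2 X) w = cutoffOp X V N w := fun _ _ => rfl
  simp only [hcoe] at hflow
  choose u hu0 hu1 hu2 hu3 using hflow
  -- Since `δ₁` and its image live on sites `|n| ≤ 2`, the first two powers of the truncated
  -- operators applied to `δ₁` do not depend on the cutoff once it is at least `2`. This makes the
  -- constants uniform in `N`.
  have hA : ∀ N, cutoffOp X V (N + 2) v = cutoffOp X V 2 v := by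
    intro N
    refine cutoffOp_eq_of_support V (by omega) fun n hn => ?_
    exact delta_one_eq_zero X fun h => by rw [h] at hn; norm_num at hn
  have hAA : ∀ N, cutoffOp X V (N + 2) (cutoffOp X V 2 v) = cutoffOp X V 2 (cutoffOp X V 2 v) := by
    intro N
    exact cutoffOp_eq_of_support V (by omega) fun n hn => cutoffOp_delta_support X V 2 n hn
  simp only [hA, hAA] at hu2 hu3
  -- A limit along an ultrafilter converges for all of the uncountably many times at once, with no
  -- choice of subsequence.
  set l : Ultrafilter ℕ := hyperfilter ℕ with hl
  have hlt : (l : Filter ℕ) ≤ atTop := by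
    rw [← Nat.cofinite_eq_atTop]; exact hyperfilter_le_cofinite
  have hlim : ∀ t (n : X.sites), ∃ x : ℂ, Tendsto (fun N => u N t n) l (𝓝 x) := by
    intro t n
    have hK : IsCompact (Metric.closedBall (0 : ℂ) ‖v‖) := isCompact_closedBall _ _
    obtain ⟨x, -, hx⟩ := hK.ultrafilter_le_nhds (l.map fun N => u N t n) (by
      rw [le_principal_iff]
      refine Eventually.of_forall (f := (l : Filter ℕ)) fun N => ?_
      rw [mem_closedBall_zero_iff, ← hu1 N t]
      exact lp.norm_apply_le_norm two_ne_zero _ _)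
    exact ⟨x, hx⟩
  choose f hf using hlim
  have hf' : ∀ t, Tendsto (id fun N => (u N t : X.sites → ℂ)) l (𝓝 (f t)) :=
    fun t => tendsto_pi_nhds.2 (hf t)
  have hmem : ∀ t, Memℓp (f t) 2 := fun t => lp.memℓp_of_tendsto
    (F := fun N => u N t) (isBounded_iff_forall_norm_le.2
      ⟨‖v‖, by rintro _ ⟨N, rfl⟩; exact (hu1 N t).le⟩) (hf' t)
  have hD : ∀ t, ∀ n, Tendsto (fun N => cutoffOp X V (N + 2) (u N t) n) l
      (𝓝 (diffExpr X V (f t) n)) := fun t n => tendsto_diffExpr_cutoff V hlt (hf t) n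
  have hmemD : ∀ t, Memℓp (diffExpr X V (f t)) 2 := fun t => lp.memℓp_of_tendsto
    (l := (l : Filter ℕ)) (F := fun N => cutoffOp X V (N + 2) (u N t))
    (isBounded_iff_forall_norm_le.2
      ⟨_, by rintro _ ⟨N, rfl⟩; exact (hu2 N t).le⟩) (tendsto_pi_nhds.2 (hD t))
  set ψ : ℝ → Ell2 X := fun t => ⟨f t, hmem t⟩ with hψ
  refine ⟨ψ, ?_, fun s => ⟨hmemD s, hasDerivAt_of_norm_sub_le_sq
    (K := ‖cutoffOp X V 2 (cutoffOp X V 2 v)‖) fun t => ?_⟩⟩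
  · apply lp.ext
    funext n
    refine tendsto_nhds_unique (hf 0 n) ?_
    simp only [hu0]
    exact tendsto_const_nhds
  · refine lp.norm_le_of_tendsto (l := (l : Filter ℕ)) (F := fun N => u N t - u N s
      - (t - s) • (-Complex.I • cutoffOp X V (N + 2) (u N s)))
      (Eventually.of_forall fun N => hu3 N s t) (tendsto_pi_nhds.2 fun n => ?_)
    exact ((hf t n).sub (hf s n)).sub (((hD s n).const_smul (-Complex.I)).const_smul (t - s))

theorem isSchrodingerFlow_evolution (X : Lattice) (V : ℤ → ℝ) :
    IsSchrodingerFlow (schrodingerOp X V) (delta X X.one)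
      (schrodingerEvolution (schrodingerOp X V) (delta X X.one)) :=
  Classical.epsilon_spec (exists_schrodingerFlow X V)

/-! ### The resolvent as the Laplace transform of the flow -/

theorem norm_exp_I_mul (E ε t : ℝ) :
    ‖Complex.exp (Complex.I * (E + Complex.I * ε) * t)‖ = Real.exp (-ε * t) := by
  rw [Complex.norm_exp]; simp

theorem integrableOn_exp_mul {f : ℝ → ℂ} (hc : Continuous f) {K : ℝ} (hb : ∀ t, ‖f t‖ ≤ K)
    (E : ℝ) {ε : ℝ} (hε : 0 < ε) : IntegrableOn
      (fun t : ℝ => Complex.exp (Complex.I * (E + Complex.I * ε) * t) * f t) (Set.Ioi 0) := by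
  refine ((exp_neg_integrableOn_Ioi 0 hε).mul_const K).mono' (by fun_prop)
    (ae_of_all _ fun t => ?_)
  rw [norm_mul, norm_exp_I_mul]
  exact mul_le_mul_of_nonneg_left (hb t) (Real.exp_nonneg _)

/-- The function `n ↦ i ∫₀^∞ e^{i(E+iε)t} ψ_n(t) dt`. -/
noncomputable def laplaceFlow {X : Lattice} (ψ : ℝ → Ell2 X) (ε E : ℝ) (n : X.sites) : ℂ :=
  Complex.I * ∫ t in Set.Ioi (0 : ℝ),
    Complex.exp (Complex.I * (E + Complex.I * ε) * t) * ψ t n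

theorem IsSchrodingerFlow.norm_le_one {X : Lattice} {V : ℤ → ℝ} {ψ : ℝ → Ell2 X}
    (h : IsSchrodingerFlow (schrodingerOp X V) (delta X X.one) ψ) (t : ℝ) : ‖ψ t‖ ≤ 1 := by
  classical
  rw [h.norm_eq (schrodingerOp_symm X V) t, delta, lp.norm_single (by norm_num)]
  simp

theorem IsSchrodingerFlow.continuous {X : Lattice} {V : ℤ → ℝ} {φ : Ell2 X} {ψ : ℝ → Ell2 X}
    (h : IsSchrodingerFlow (schrodingerOp X V) φ ψ) : Continuous ψ :=
  continuous_iff_continuousAt.2 fun t => (h.2 t).choose_spec.continuousAt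

theorem continuous_zeroExt {X : Lattice} {ψ : ℝ → Ell2 X} (h : Continuous ψ) (m : ℤ) :
    Continuous fun t => zeroExt (ψ t : X.sites → ℂ) m := by
  by_cases hm : m ∈ X.sites
  · simp only [zeroExt, hm, dif_pos]
    exact (lp.evalCLM ℂ (fun _ : X.sites => ℂ) 2 ⟨m, hm⟩).continuous.comp h
  · simp only [zeroExt_of_notMem _ hm]
    exact continuous_const

theorem norm_zeroExt_le {X : Lattice} (ψ : Ell2 X) (m : ℤ) :
    ‖zeroExt (ψ : X.sites → ℂ) m‖ ≤ ‖ψ‖ := by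
  by_cases hm : m ∈ X.sites
  · simp only [zeroExt, hm, dif_pos]
    exact lp.norm_apply_le_norm two_ne_zero _ _
  · simp only [zeroExt_of_notMem _ hm]
    simp

theorem zeroExt_laplaceFlow {X : Lattice} (ψ : ℝ → Ell2 X) (ε E : ℝ) (m : ℤ) :
    zeroExt (laplaceFlow ψ ε E) m = Complex.I * ∫ t in Set.Ioi (0 : ℝ),
      Complex.exp (Complex.I * (E + Complex.I * ε) * t) * zeroExt (ψ t : X.sites → ℂ) m := by
  by_cases hm : m ∈ X.sites
  · simp only [zeroExt, hm, dif_pos, laplaceFlow]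
  · simp only [zeroExt_of_notMem _ hm]
    simp

section

variable {X : Lattice} {V : ℤ → ℝ} {ψ : ℝ → Ell2 X}

/-- Integrate the derivative of `e^{izt} ψ_n(t)` over `t > 0`: the damping kills the term at
infinity, and the term at `t = 0` is the source `δ₁`. -/
theorem diffExpr_laplaceFlow (h : IsSchrodingerFlow (schrodingerOp X V) (delta X X.one) ψ) {ε : ℝ}
    (hε : 0 < ε) (E : ℝ) (n : X.sites) :
    diffExpr X V (laplaceFlow ψ ε E) n
      = (E + Complex.I * ε) * laplaceFlow ψ ε E n + delta X X.one n := by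
  set e : ℝ → ℂ := fun t => Complex.exp (Complex.I * (E + Complex.I * ε) * t) with he
  have hint : ∀ m : ℤ, IntegrableOn (fun t => e t * zeroExt (ψ t : X.sites → ℂ) m) (Set.Ioi 0) :=
    fun m => integrableOn_exp_mul (continuous_zeroExt h.continuous m)
      (fun t => (norm_zeroExt_le (ψ t) m).trans (h.norm_le_one t)) E hε
  have hint0 : IntegrableOn (fun t => e t * ψ t n) (Set.Ioi 0) := by
    simpa only [zeroExt_coe] using hint n
  have hDeq : (fun t => e t * diffExpr X V (ψ t : X.sites → ℂ) n)
      = fun t => (e t * zeroExt (ψ t : X.sites → ℂ) (n + 1)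
        + e t * zeroExt (ψ t : X.sites → ℂ) (n - 1)) + (V n : ℂ) * (e t * ψ t n) := by
    funext t; rw [diffExpr]; ring
  have hD : IntegrableOn (fun t => e t * diffExpr X V (ψ t : X.sites → ℂ) n) (Set.Ioi 0) := by
    rw [hDeq]
    exact ((hint _).add (hint _)).add (hint0.const_mul _)
  have hdiff : diffExpr X V (laplaceFlow ψ ε E) n
      = Complex.I * ∫ t in Set.Ioi (0 : ℝ), e t * diffExpr X V (ψ t : X.sites → ℂ) n := by
    have h3 := (integral_add ((hint (n + 1)).add (hint (n - 1)))
      (hint0.const_mul (V n : ℂ))).trans (congrArg₂ (· + ·)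
        (integral_add (hint (n + 1)) (hint (n - 1))) (integral_const_mul _ _))
    rw [hDeq, diffExpr, zeroExt_laplaceFlow, zeroExt_laplaceFlow, laplaceFlow]
    refine Eq.trans ?_ (congrArg (Complex.I * ·) h3.symm)
    ring
  have hder : ∀ t, HasDerivAt (fun t => e t * ψ t n)
      (Complex.I * (E + Complex.I * ε) * (e t * ψ t n)
        - Complex.I * (e t * diffExpr X V (ψ t : X.sites → ℂ) n)) t := by
    intro t
    obtain ⟨ht, hdt⟩ := h.2 t
    have h1 : HasDerivAt (fun t => ψ t n) (-Complex.I * diffExpr X V (ψ t : X.sites → ℂ) n) t :=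
      ((lp.evalCLM ℂ (fun _ : X.sites => ℂ) 2 n).restrictScalars ℝ).hasFDerivAt.comp_hasDerivAt
        t hdt
    have h2 : HasDerivAt e (e t * (Complex.I * (E + Complex.I * ε))) t := by
      have h3 : HasDerivAt (fun t : ℝ => Complex.I * (E + Complex.I * ε) * (t : ℂ))
          (Complex.I * (E + Complex.I * ε)) t := by
        simpa using (Complex.ofRealCLM.hasDerivAt (x := t)).const_mul
          (Complex.I * (E + Complex.I * ε))
      exact h3.cexp
    convert! h2.mul h1 using 1
    ring
  have hlim : Tendsto (fun t => e t * ψ t n) atTop (𝓝 0) := by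
    refine squeeze_zero_norm (a := fun t => Real.exp (-ε * t)) (fun t => ?_) ?_
    · rw [norm_mul, he, norm_exp_I_mul]
      exact mul_le_of_le_one_right (Real.exp_nonneg _)
        ((lp.norm_apply_le_norm two_ne_zero _ _).trans (h.norm_le_one t))
    · simp only [neg_mul]
      exact Real.tendsto_exp_neg_atTop_nhds_zero.comp (tendsto_id.const_mul_atTop hε)
  have hftc := integral_Ioi_of_hasDerivAt_of_tendsto' (a := 0) (fun t _ => hder t)
    ((hint0.const_mul _).sub (hD.const_mul _)) hlim
  rw [integral_sub (hint0.const_mul _) (hD.const_mul _), integral_const_mul, integral_const_mul,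
    ← hdiff, h.1] at hftc
  have e0 : e 0 = 1 := by simp [he]
  rw [e0] at hftc
  rw [laplaceFlow]
  linear_combination -hftc

/-- The coordinates are those of a single Bochner integral with values in `ℓ²`. -/
theorem memℓp_laplaceFlow (h : IsSchrodingerFlow (schrodingerOp X V) (delta X X.one) ψ) {ε : ℝ}
    (hε : 0 < ε) (E : ℝ) : Memℓp (laplaceFlow ψ ε E) 2 := by
  have hi : IntegrableOn (fun t : ℝ => Complex.exp (Complex.I * (E + Complex.I * ε) * t) • ψ t)
      (Set.Ioi 0) := by
    have hc := h.continuous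
    refine (exp_neg_integrableOn_Ioi 0 hε).mono' ?_ (ae_of_all _ fun t => ?_)
    · exact Continuous.aestronglyMeasurable (by fun_prop)
    · rw [norm_smul, norm_exp_I_mul]
      exact mul_le_of_le_one_right (Real.exp_nonneg _) (h.norm_le_one t)
  have heq : laplaceFlow ψ ε E = ((Complex.I • ∫ t in Set.Ioi (0 : ℝ),
      Complex.exp (Complex.I * (E + Complex.I * ε) * t) • ψ t : Ell2 X) : X.sites → ℂ) := by
    funext n
    have := (lp.evalCLM ℂ (fun _ : X.sites => ℂ) 2 n).integral_comp_comm hi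
    rw [laplaceFlow, lp.coeFn_smul, Pi.smul_apply, smul_eq_mul]
    congr 1
  rw [heq]
  exact lp.memℓp _

/-- An eigenvalue of a symmetric operator is real. -/
theorem eq_of_schrodingerOp_sub_smul_eq {z : ℂ} (hz : z.im ≠ 0)
    {a b : (schrodingerOp X V).domain}
    (hab : schrodingerOp X V a - z • (a : Ell2 X) = schrodingerOp X V b - z • (b : Ell2 X)) :
    a = b := by
  rw [← sub_eq_zero]
  set w := a - b with hw
  have hHw : schrodingerOp X V w = z • (w : Ell2 X) := by
    rw [hw, LinearPMap.map_sub]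
    push_cast
    rw [smul_sub, sub_eq_sub_iff_sub_eq_sub]
    rw [sub_eq_sub_iff_add_eq_add] at hab ⊢
    rw [hab]
  have hs := schrodingerOp_symm X V w w
  rw [hHw, inner_smul_left, inner_smul_right] at hs
  by_contra hne
  have hne' : inner ℂ (w : Ell2 X) (w : Ell2 X) ≠ 0 := by
    rw [Ne, inner_self_eq_zero]
    exact fun h0 => hne (Subtype.ext h0)
  have := mul_right_cancel₀ hne' hs
  exact hz (Complex.conj_eq_iff_im.1 this)

theorem borelTransform_eq_laplaceFlow
    (h : IsSchrodingerFlow (schrodingerOp X V) (delta X X.one) ψ) {ε : ℝ}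
    (hε : 0 < ε) (E : ℝ) :
    borelTransform X V ((E : ℂ) + Complex.I * (ε : ℂ)) = laplaceFlow ψ ε E X.one := by
  classical
  set z : ℂ := (E : ℂ) + Complex.I * (ε : ℂ) with hz
  have hzim : z.im ≠ 0 := by simp [hz, hε.ne']
  set G : Ell2 X := ⟨laplaceFlow ψ ε E, memℓp_laplaceFlow h hε E⟩ with hG
  have hdiff : diffExpr X V (G : X.sites → ℂ) = ((z • G + delta X X.one : Ell2 X) : X.sites → ℂ) := by
    funext n
    exact diffExpr_laplaceFlow h hε E n
  have hdom : G ∈ (schrodingerOp X V).domain := by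
    change Memℓp (diffExpr X V (G : X.sites → ℂ)) 2
    rw [hdiff]
    exact lp.memℓp _
  have hHG : schrodingerOp X V ⟨G, hdom⟩ - z • G = delta X X.one := by
    rw [sub_eq_iff_eq_add, add_comm]
    exact lp.ext hdiff
  have hinv := Function.invFun_eq
    (f := fun φ : (schrodingerOp X V).domain => schrodingerOp X V φ - z • (φ : Ell2 X))
    ⟨⟨G, hdom⟩, hHG⟩
  have heq : resolventMap (schrodingerOp X V) z (delta X X.one) = ⟨G, hdom⟩ :=
    eq_of_schrodingerOp_sub_smul_eq hzim (hinv.trans hHG.symm)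
  rw [borelTransform, heq, delta, lp.inner_single_left]
  simp [hG]

theorem continuous_laplaceFlow
    (h : IsSchrodingerFlow (schrodingerOp X V) (delta X X.one) ψ) {ε : ℝ}
    (hε : 0 < ε) (n : X.sites) : Continuous fun E => laplaceFlow ψ ε E n := by
  have hc : Continuous fun t => ψ t n := by
    simpa only [zeroExt_coe] using continuous_zeroExt h.continuous n
  exact continuous_const.mul (continuous_integral_laplace hc
    (fun t => (lp.norm_apply_le_norm two_ne_zero _ _).trans (h.norm_le_one t)) hε)

end

theorem timeAvgProb_eq (X : Lattice) (V : ℤ → ℝ) (n : X.sites) {T : ℝ} (hT : 0 < T) :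
    timeAvgProb X V n T = ENNReal.ofReal (1 / T / Real.pi) * ∫⁻ E : ℝ, ‖laplaceFlow
      (schrodingerEvolution (schrodingerOp X V) (delta X X.one)) (1 / T) E n‖ₑ ^ 2 := by
  classical
  have h := isSchrodingerFlow_evolution X V
  rw [timeAvgProb]
  set ψ := schrodingerEvolution (schrodingerOp X V) (delta X X.one)
  have hc : Continuous fun t => ψ t n := by
    simpa only [zeroExt_coe] using continuous_zeroExt h.continuous n
  have hp := lintegral_laplace_sq hc (ε := 1 / T)
    (fun t => (lp.norm_apply_le_norm two_ne_zero _ _).trans (h.norm_le_one t)) (by positivity)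
  have hn : ∀ E, ‖laplaceFlow ψ (1 / T) E n‖ₑ = ‖∫ t in Set.Ioi (0 : ℝ),
      Complex.exp (Complex.I * (E + Complex.I * (1 / T : ℝ)) * t) * ψ t n‖ₑ := by
    intro E
    rw [laplaceFlow, enorm_mul]
    simp [enorm_eq_nnnorm]
  simp_rw [hn]
  rw [hp, ← mul_assoc, ← ENNReal.ofReal_mul (by positivity)]
  congr 1
  · congr 1
    have := Real.pi_pos
    field_simp
  · congr 1
    funext t
    rw [delta, lp.inner_single_left]
    simp only [RCLike.inner_apply, map_one, mul_one]
    congr 3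
    ring

/-! ### The truncated norm as a weighted sum -/

/-- The weight of the site `n` in `‖u‖_L²`. -/
noncomputable def siteWeight (L : ℝ) (n : ℕ) : ℝ := max 0 (min 1 (L - (n - 1)))

/-- The sum `∑_{n=1}^N w_n(L) f(n)`. -/
noncomputable def weightedSum (N : ℕ) (L : ℝ) (f : ℕ → ℝ) : ℝ := ∑ n ∈ Finset.Icc 1 N, siteWeight L n * f n

theorem siteWeight_nonneg (L : ℝ) (n : ℕ) : 0 ≤ siteWeight L n := le_max_left _ _

theorem siteWeight_le_one (L : ℝ) (n : ℕ) : siteWeight L n ≤ 1 :=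
  max_le zero_le_one (min_le_left _ _)

theorem siteWeight_mono {L L' : ℝ} (h : L ≤ L') (n : ℕ) : siteWeight L n ≤ siteWeight L' n := by
  unfold siteWeight; gcongr

theorem siteWeight_eq_one {L : ℝ} {n : ℕ} (h : (n : ℝ) ≤ L) : siteWeight L n = 1 := by
  rw [siteWeight, min_eq_left (by linarith), max_eq_right zero_le_one]

theorem siteWeight_eq_zero {L : ℝ} {n : ℕ} (h : L ≤ n - 1) : siteWeight L n = 0 := by
  rw [siteWeight, max_eq_left]
  exact (min_le_right _ _).trans (by linarith)

theorem continuous_weightedSum (N : ℕ) (f : ℕ → ℝ) : Continuous fun L => weightedSum N L f := by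
  unfold weightedSum siteWeight; fun_prop

/-- The integer part in `normSqUpTo` hides its continuity in `L`. With clamped weights over a range
`N` independent of `L`, continuity and monotonicity are visible term by term. -/
theorem normSqUpTo_eq_weightedSum (u : ℕ → ℝ) {L : ℝ} (hL : 0 ≤ L) {N : ℕ} (hN : L ≤ N) :
    normSqUpTo u L = weightedSum N L fun n => u n ^ 2 := by
  have h1 : (⌊L⌋₊ : ℝ) ≤ L := Nat.floor_le hL
  have h2 : L < ⌊L⌋₊ + 1 := Nat.lt_floor_add_one L
  have e1 : weightedSum (max N (⌊L⌋₊ + 1)) L (fun n => u n ^ 2)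
      = weightedSum N L fun n => u n ^ 2 := by
    symm
    refine Finset.sum_subset (Finset.Icc_subset_Icc_right (le_max_left _ _)) fun n hn hn' => ?_
    rw [Finset.mem_Icc] at hn hn'
    have : N + 1 ≤ n := by omega
    have : (N : ℝ) + 1 ≤ n := by exact_mod_cast this
    rw [siteWeight_eq_zero (by linarith), zero_mul]
  have e2 : weightedSum (max N (⌊L⌋₊ + 1)) L (fun n => u n ^ 2)
      = weightedSum (⌊L⌋₊ + 1) L fun n => u n ^ 2 := by
    symm
    refine Finset.sum_subset (Finset.Icc_subset_Icc_right (le_max_right _ _)) fun n hn hn' => ?_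
    rw [Finset.mem_Icc] at hn hn'
    have : ⌊L⌋₊ + 2 ≤ n := by omega
    have : (⌊L⌋₊ : ℝ) + 2 ≤ n := by exact_mod_cast this
    rw [siteWeight_eq_zero (by linarith), zero_mul]
  rw [← e1, e2, normSqUpTo, weightedSum, Finset.sum_Icc_succ_top (by omega)]
  congr 1
  · refine Finset.sum_congr rfl fun n hn => ?_
    have : n ≤ ⌊L⌋₊ := (Finset.mem_Icc.1 hn).2
    have : (n : ℝ) ≤ ⌊L⌋₊ := by exact_mod_cast this
    rw [siteWeight_eq_one (by linarith), one_mul]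
  · rw [siteWeight, min_eq_right (by push_cast; linarith), max_eq_right (by push_cast; linarith)]
    push_cast; ring

theorem weightedSum_nonneg (N : ℕ) (L : ℝ) {f : ℕ → ℝ} (hf : ∀ n, 0 ≤ f n) :
    0 ≤ weightedSum N L f :=
  Finset.sum_nonneg fun n _ => mul_nonneg (siteWeight_nonneg L n) (hf n)

theorem normSqUpTo_mono (u : ℕ → ℝ) {L L' : ℝ} (hL : 0 ≤ L) (h : L ≤ L') :
    normSqUpTo u L ≤ normSqUpTo u L' := by
  obtain ⟨N, hN⟩ := exists_nat_ge L'
  rw [normSqUpTo_eq_weightedSum u hL (h.trans hN),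
    normSqUpTo_eq_weightedSum u (hL.trans h) hN]
  exact Finset.sum_le_sum fun n _ => mul_le_mul_of_nonneg_right (siteWeight_mono h n) (sq_nonneg _)

theorem normSqUpTo_nonneg (u : ℕ → ℝ) {L : ℝ} (hL : 0 ≤ L) : 0 ≤ normSqUpTo u L := by
  obtain ⟨N, hN⟩ := exists_nat_ge L
  rw [normSqUpTo_eq_weightedSum u hL hN]
  exact weightedSum_nonneg N L fun n => sq_nonneg _

/-! ### Solutions with prescribed initial data -/

/-- The solution at energy `E` with `u(0) = x` and `u(1) = y`. -/
noncomputable def solutionOf (V : ℤ → ℝ) (E x y : ℝ) : ℕ → ℝ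
  | 0 => x
  | 1 => y
  | n + 2 => (E - V ((n : ℤ) + 1)) * solutionOf V E x y (n + 1) - solutionOf V E x y n

theorem solutionOf_add_two (V : ℤ → ℝ) (E x y : ℝ) (n : ℕ) : solutionOf V E x y (n + 2)
    = (E - V ((n : ℤ) + 1)) * solutionOf V E x y (n + 1) - solutionOf V E x y n := by
  rw [solutionOf]

theorem isSolution_solutionOf (V : ℤ → ℝ) (E x y : ℝ) : IsSolution V E (solutionOf V E x y) := by
  intro n hn
  obtain ⟨m, rfl⟩ := Nat.exists_eq_add_of_le' hn
  simp only [Nat.add_sub_cancel]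
  rw [solutionOf_add_two]
  push_cast
  ring

theorem solutionOf_eq (V : ℤ → ℝ) (E x y : ℝ) (n : ℕ) : solutionOf V E x y n
    = x * solutionOf V E 1 0 n + y * solutionOf V E 0 1 n := by
  induction n using Nat.twoStepInduction with
  | zero => simp [solutionOf]
  | one => simp [solutionOf]
  | more n h1 h2 => rw [solutionOf_add_two, h1, h2, solutionOf_add_two, solutionOf_add_two]; ring

theorem wronskian_solutionOf (V : ℤ → ℝ) (E : ℝ) (n : ℕ) :
    solutionOf V E 1 0 n * solutionOf V E 0 1 (n + 1)
      - solutionOf V E 0 1 n * solutionOf V E 1 0 (n + 1) = 1 := by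
  induction n with
  | zero => simp [solutionOf]
  | succ n ih => rw [solutionOf_add_two, solutionOf_add_two]; linear_combination ih

theorem IsSolution.smul {V : ℤ → ℝ} {E : ℝ} {u : ℕ → ℝ} (h : IsSolution V E u) (c : ℝ) :
    IsSolution V E fun n => c * u n := by
  intro n hn
  linear_combination c * h n hn

theorem normSqUpTo_smul (u : ℕ → ℝ) (c L : ℝ) :
    normSqUpTo (fun n => c * u n) L = c ^ 2 * normSqUpTo u L := by
  simp only [normSqUpTo, mul_pow, ← Finset.mul_sum]
  ring

theorem le_normSqUpTo_of_forall_normalized {V : ℤ → ℝ} {E B L : ℝ} (hL : 0 ≤ L)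
    (hB : ∀ u, IsSolution V E u → IsNormalized u → B ≤ normSqUpTo u L)
    {u : ℕ → ℝ} (hu : IsSolution V E u) : B * (u 0 ^ 2 + u 1 ^ 2) ≤ normSqUpTo u L := by
  set s := u 0 ^ 2 + u 1 ^ 2 with hs
  rcases (by positivity : 0 ≤ s).eq_or_lt with h0 | h0
  · rw [← h0, mul_zero]; exact normSqUpTo_nonneg u hL
  · have hsq : (√s)⁻¹ ^ 2 = s⁻¹ := by rw [inv_pow, Real.sq_sqrt h0.le]
    have := hB _ (hu.smul (√s)⁻¹) (by
      rw [IsNormalized, mul_pow, mul_pow, ← mul_add, ← hs, hsq, inv_mul_cancel₀ h0.ne'])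
    rw [normSqUpTo_smul, hsq] at this
    rwa [← le_div_iff₀ h0, div_eq_inv_mul]

/-! ### The Gram determinant -/

/-- The Gram determinant of the two basic solutions in the truncated norm. -/
noncomputable def gramDet (V : ℤ → ℝ) (E : ℝ) (N : ℕ) (L : ℝ) : ℝ :=
  weightedSum N L (fun n => solutionOf V E 1 0 n ^ 2)
      * weightedSum N L (fun n => solutionOf V E 0 1 n ^ 2)
    - weightedSum N L (fun n => solutionOf V E 1 0 n * solutionOf V E 0 1 n) ^ 2

theorem continuous_gramDet (V : ℤ → ℝ) (E : ℝ) (N : ℕ) : Continuous (gramDet V E N) :=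
  ((continuous_weightedSum _ _).mul (continuous_weightedSum _ _)).sub
    ((continuous_weightedSum _ _).pow 2)

theorem weightedSum_solutionOf_sq (V : ℤ → ℝ) (E x y : ℝ) (N : ℕ) (L : ℝ) :
    weightedSum N L (fun n => solutionOf V E x y n ^ 2)
      = x ^ 2 * weightedSum N L (fun n => solutionOf V E 1 0 n ^ 2)
        + 2 * x * y * weightedSum N L (fun n => solutionOf V E 1 0 n * solutionOf V E 0 1 n)
        + y ^ 2 * weightedSum N L (fun n => solutionOf V E 0 1 n ^ 2) := by
  simp only [weightedSum, Finset.mul_sum, ← Finset.sum_add_distrib]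
  refine Finset.sum_congr rfl fun n _ => ?_
  rw [solutionOf_eq V E x y]
  ring

/-- Lagrange's identity: the Gram determinant is half the squared Hilbert–Schmidt norm of the
variation-of-parameters kernel. -/
theorem weightedSum_sum_wronskian_sq (N : ℕ) (L : ℝ) (p q : ℕ → ℝ) :
    weightedSum N L (fun n => weightedSum N L fun j => (p j * q n - q j * p n) ^ 2)
      = 2 * (weightedSum N L (fun n => p n ^ 2) * weightedSum N L (fun n => q n ^ 2)
        - weightedSum N L (fun n => p n * q n) ^ 2) := by
  set a := weightedSum N L (fun n => p n ^ 2) with ha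
  set b := weightedSum N L (fun n => q n ^ 2) with hb
  set c := weightedSum N L (fun n => p n * q n) with hc
  have h1 : ∀ n, weightedSum N L (fun j => (p j * q n - q j * p n) ^ 2)
      = a * q n ^ 2 - 2 * c * (p n * q n) + b * p n ^ 2 := by
    intro n
    simp only [ha, hb, hc, weightedSum, Finset.mul_sum, Finset.sum_mul,
      ← Finset.sum_add_distrib, ← Finset.sum_sub_distrib]
    exact Finset.sum_congr rfl fun j _ => by ring
  simp_rw [h1]
  have h2 : ∀ A B C : ℝ, weightedSum N L (fun n => A * q n ^ 2 - 2 * C * (p n * q n) + B * p n ^ 2)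
      = A * b - 2 * C * c + B * a := by
    intro A B C
    simp only [ha, hb, hc, weightedSum, Finset.mul_sum,
      ← Finset.sum_add_distrib, ← Finset.sum_sub_distrib]
    exact Finset.sum_congr rfl fun j _ => by ring
  rw [h2]; ring

/-- A rotation of the initial data preserves the Gram determinant, which is at most the product of
its diagonal entries. -/
theorem gramDet_le_mul (V : ℤ → ℝ) (E x y : ℝ) (hxy : x ^ 2 + y ^ 2 = 1) (N : ℕ) (L : ℝ) :
    gramDet V E N L ≤ weightedSum N L (fun n => solutionOf V E x y n ^ 2)
      * weightedSum N L (fun n => solutionOf V E (-y) x n ^ 2) := by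
  rw [weightedSum_solutionOf_sq V E x y, weightedSum_solutionOf_sq V E (-y) x, gramDet]
  set a := weightedSum N L (fun n => solutionOf V E 1 0 n ^ 2)
  set b := weightedSum N L (fun n => solutionOf V E 0 1 n ^ 2)
  set c := weightedSum N L (fun n => solutionOf V E 1 0 n * solutionOf V E 0 1 n)
  have h : (x ^ 2 * a + 2 * x * y * c + y ^ 2 * b)
      * ((-y) ^ 2 * a + 2 * (-y) * x * c + x ^ 2 * b)
      = (a * b - c ^ 2) * (x ^ 2 + y ^ 2) ^ 2
        + (-(x * y) * a + (x ^ 2 - y ^ 2) * c + x * y * b) ^ 2 := by ring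
  rw [h, hxy]
  nlinarith [sq_nonneg (-(x * y) * a + (x ^ 2 - y ^ 2) * c + x * y * b)]

/-- The Gram form minus `m` times the identity is nonnegative, so both eigenvalues are at least `m`.
-/
theorem sq_le_gramDet (V : ℤ → ℝ) (E : ℝ) (N : ℕ) (L m : ℝ) (hm : 0 ≤ m)
    (h : ∀ x y, m * (x ^ 2 + y ^ 2) ≤ weightedSum N L (fun n => solutionOf V E x y n ^ 2)) :
    m ^ 2 ≤ gramDet V E N L := by
  have h' := fun x y => (h x y).trans_eq (weightedSum_solutionOf_sq V E x y N L)
  rw [gramDet]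
  set a := weightedSum N L (fun n => solutionOf V E 1 0 n ^ 2)
  set b := weightedSum N L (fun n => solutionOf V E 0 1 n ^ 2)
  set c := weightedSum N L (fun n => solutionOf V E 1 0 n * solutionOf V E 0 1 n)
  have ha : m ≤ a := by have := h' 1 0; linarith
  have hb : m ≤ b := by have := h' 0 1; linarith
  have hd := discrim_le_zero (a := a - m) (b := 2 * c) (c := b - m) fun x => by
    have := h' x 1; nlinarith
  rw [discrim] at hd
  nlinarith

/-! ### Perturbation of the energy -/

section Perturbation

variable {V : ℤ → ℝ} {E : ℝ} {z : ℂ} {c : ℕ → ℂ}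

/-- Variation of parameters. -/
theorem sub_solution_eq (hc : ∀ n, c (n + 2) = (z - V ((n : ℤ) + 1)) * c (n + 1) - c n) (n : ℕ) :
    c n - (c 0 * solutionOf V E 1 0 n + c 1 * solutionOf V E 0 1 n)
      = (z - E) * ∑ j ∈ Finset.Ico 1 n, ((solutionOf V E 1 0 j * solutionOf V E 0 1 n
        - solutionOf V E 0 1 j * solutionOf V E 1 0 n : ℝ) : ℂ) * c j := by
  induction n using Nat.twoStepInduction with
  | zero => simp [solutionOf]
  | one => simp [solutionOf]
  | more n h1 h2 =>
    -- The kernel solves the recursion at `E` in its second index, vanishes on the diagonal (`h3`),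
    -- and equals the Wronskian, which is `1`, one step above it; that value produces the source
    -- term.
    have hw : ((solutionOf V E 1 0 (n + 1) * solutionOf V E 0 1 (n + 2)
        - solutionOf V E 0 1 (n + 1) * solutionOf V E 1 0 (n + 2) : ℝ) : ℂ) = 1 := by
      rw [wronskian_solutionOf]; simp
    have h3 : ∑ j ∈ Finset.Ico 1 (n + 1), ((solutionOf V E 1 0 j * solutionOf V E 0 1 n
        - solutionOf V E 0 1 j * solutionOf V E 1 0 n : ℝ) : ℂ) * c j
        = ∑ j ∈ Finset.Ico 1 n, ((solutionOf V E 1 0 j * solutionOf V E 0 1 n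
        - solutionOf V E 0 1 j * solutionOf V E 1 0 n : ℝ) : ℂ) * c j := by
      rcases Nat.eq_zero_or_pos n with rfl | hn
      · simp
      · rw [Finset.sum_Ico_succ_top hn, mul_comm (solutionOf V E 0 1 n)]; simp
    have h4 : ∑ j ∈ Finset.Ico 1 (n + 1), ((solutionOf V E 1 0 j * solutionOf V E 0 1 (n + 2)
        - solutionOf V E 0 1 j * solutionOf V E 1 0 (n + 2) : ℝ) : ℂ) * c j
        = (E - V ((n : ℤ) + 1)) * ∑ j ∈ Finset.Ico 1 (n + 1),
          ((solutionOf V E 1 0 j * solutionOf V E 0 1 (n + 1)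
          - solutionOf V E 0 1 j * solutionOf V E 1 0 (n + 1) : ℝ) : ℂ) * c j
          - ∑ j ∈ Finset.Ico 1 (n + 1), ((solutionOf V E 1 0 j * solutionOf V E 0 1 n
        - solutionOf V E 0 1 j * solutionOf V E 1 0 n : ℝ) : ℂ) * c j := by
      rw [Finset.mul_sum, ← Finset.sum_sub_distrib]
      refine Finset.sum_congr rfl fun j _ => ?_
      rw [solutionOf_add_two, solutionOf_add_two]
      push_cast; ring
    rw [Finset.sum_Ico_succ_top (by omega), hw, h4, h3, hc n, solutionOf_add_two,
      solutionOf_add_two]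
    push_cast at h1 h2 ⊢
    linear_combination (E - V ((n : ℤ) + 1) : ℂ) * h2 - h1

theorem weightedSum_norm_sub_sq_le
    (hc : ∀ n, c (n + 2) = (z - V ((n : ℤ) + 1)) * c (n + 1) - c n) (N : ℕ) (L : ℝ) :
    weightedSum N L (fun n =>
        ‖c n - (c 0 * solutionOf V E 1 0 n + c 1 * solutionOf V E 0 1 n)‖ ^ 2)
      ≤ ‖z - E‖ ^ 2 * (2 * gramDet V E N L) * weightedSum N L fun n => ‖c n‖ ^ 2 := by
  set p := solutionOf V E 1 0 with hp
  set q := solutionOf V E 0 1 with hq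
  rw [gramDet, ← weightedSum_sum_wronskian_sq]
  conv_lhs => rw [weightedSum]
  conv_rhs => rw [weightedSum, Finset.mul_sum, Finset.sum_mul]
  refine Finset.sum_le_sum fun n hn => ?_
  rw [Finset.mem_Icc] at hn
  rcases (siteWeight_nonneg L n).eq_or_lt with h0 | h0
  · rw [← h0]; simp
  have hnL : (n : ℝ) - 1 < L := by
    by_contra hcon
    rw [siteWeight_eq_zero (not_lt.1 hcon)] at h0
    exact lt_irrefl _ h0
  -- A site of positive weight has only full-weight sites before it, so the triangular sum over `j <
  -- n` is bounded by the weighted sum.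
  have hone : ∀ j ∈ Finset.Ico 1 n, siteWeight L j = 1 := by
    intro j hj
    have : j + 1 ≤ n := (Finset.mem_Ico.1 hj).2
    have : (j : ℝ) + 1 ≤ n := by exact_mod_cast this
    exact siteWeight_eq_one (by linarith)
  have hle : ∀ f : ℕ → ℝ, (∀ j, 0 ≤ f j) → ∑ j ∈ Finset.Ico 1 n, f j ≤ weightedSum N L f := by
    intro f hf
    have : ∑ j ∈ Finset.Ico 1 n, f j = ∑ j ∈ Finset.Ico 1 n, siteWeight L j * f j :=
      Finset.sum_congr rfl fun j hj => by rw [hone j hj, one_mul]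
    rw [this]
    refine Finset.sum_le_sum_of_subset_of_nonneg (fun j hj => ?_)
      fun j _ _ => mul_nonneg (siteWeight_nonneg L j) (hf j)
    rw [Finset.mem_Ico] at hj
    rw [Finset.mem_Icc]; omega
  rw [sub_solution_eq hc n, norm_mul, mul_pow]
  have h1 : ‖∑ j ∈ Finset.Ico 1 n, ((p j * q n - q j * p n : ℝ) : ℂ) * c j‖ ^ 2
      ≤ weightedSum N L (fun j => (p j * q n - q j * p n) ^ 2)
        * weightedSum N L (fun n => ‖c n‖ ^ 2) := by
    calc _ ≤ (∑ j ∈ Finset.Ico 1 n, |p j * q n - q j * p n| * ‖c j‖) ^ 2 := by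
          gcongr
          refine (norm_sum_le _ _).trans_eq (Finset.sum_congr rfl fun j _ => ?_)
          rw [norm_mul, Complex.norm_real, Real.norm_eq_abs]
      _ ≤ (∑ j ∈ Finset.Ico 1 n, |p j * q n - q j * p n| ^ 2)
          * ∑ j ∈ Finset.Ico 1 n, ‖c j‖ ^ 2 := Finset.sum_mul_sq_le_sq_mul_sq _ _ _
      _ ≤ _ := by
          simp only [sq_abs]
          exact mul_le_mul (hle _ fun j => sq_nonneg _) (hle _ fun j => sq_nonneg _)
            (Finset.sum_nonneg fun j _ => sq_nonneg _)
            (weightedSum_nonneg _ _ fun j => sq_nonneg _)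
  calc _ ≤ siteWeight L n * (‖z - E‖ ^ 2 * (weightedSum N L
        (fun j => (p j * q n - q j * p n) ^ 2) * weightedSum N L (fun n => ‖c n‖ ^ 2))) := by
        gcongr
    _ = _ := by ring

end Perturbation

/-! ### Power-law growth of solutions -/

theorem normSqUpTo_two (u : ℕ → ℝ) : normSqUpTo u 2 = u 1 ^ 2 + u 2 ^ 2 := by
  simp [normSqUpTo, Finset.sum_Icc_succ_top]

theorem isNormalized_solutionOf (V : ℤ → ℝ) (E : ℝ) {x y : ℝ} (h : x ^ 2 + y ^ 2 = 1) :
    IsNormalized (solutionOf V E x y) := by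
  simpa [IsNormalized, solutionOf] using h

/-- A normalized solution may vanish at `1`, so length `2` is needed. Hypothesis (a) for the data
`(0, 1)` bounds `(E - V 1)²` on `A`, and the equation at site `1` then controls `u 0` by `u 1` and
`u 2`. -/
theorem UpperPowerBound.le_normSqUpTo_two {V : ℤ → ℝ} {A : Set ℝ} {C α : ℝ}
    (ha : UpperPowerBound V A C α) {E : ℝ} (hE : E ∈ A) {u : ℕ → ℝ} (hu : IsSolution V E u)
    (hn : IsNormalized u) : 1 ≤ (2 * (C * 2 ^ (2 * α + 1)) + 2) * normSqUpTo u 2 := by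
  have hq := ha E hE _ (isSolution_solutionOf V E 0 1) (isNormalized_solutionOf V E (by norm_num))
    2 (by norm_num)
  rw [normSqUpTo_two] at hq ⊢
  simp only [solutionOf] at hq
  set K := C * 2 ^ (2 * α + 1)
  have h2 : u 2 + u 0 + V 1 * u 1 = E * u 1 := by simpa using hu 1 le_rfl
  have hK : (E - V 1) ^ 2 ≤ K := by norm_num at hq; linarith
  have h0 : u 0 = (E - V 1) * u 1 - u 2 := by linear_combination h2
  rw [IsNormalized] at hn
  have h3 : u 0 ^ 2 ≤ 2 * ((E - V 1) ^ 2 * u 1 ^ 2) + 2 * u 2 ^ 2 := by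
    rw [h0]; nlinarith [sq_nonneg ((E - V 1) * u 1 + u 2)]
  have h4 := mul_le_mul_of_nonneg_right hK (sq_nonneg (u 1))
  have h5 := mul_nonneg ((sq_nonneg (E - V 1)).trans hK) (sq_nonneg (u 2))
  nlinarith [sq_nonneg (u 1), sq_nonneg (u 2)]

/-- Each stretching of `L` by `1/k` multiplies `‖u‖_L²` by at least `1 + γ`. This gives the exponent
`β = log(1+γ)/log(1/k)` for the square, hence `κ = β/2`. -/
theorem exists_lowerPowerBound {V : ℤ → ℝ} {A : Set ℝ} {C α k γ L₀ : ℝ} (hC : 0 < C)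
    (hk0 : 0 < k) (hk1 : k < 1) (hγ0 : 0 < γ)
    (ha : UpperPowerBound V A C α) (hb : ScalingLowerBound V A k γ L₀) :
    ∃ D κ L₁ : ℝ, 0 < D ∧ 0 < κ ∧ 1 ≤ L₁ ∧ LowerPowerBound V A D κ L₁ := by
  set R : ℝ := max L₀ 2 with hR
  have hR2 : 2 ≤ R := le_max_right _ _
  have hR0 : 0 < R := by linarith
  set K : ℝ := 2 * (C * 2 ^ (2 * α + 1)) + 2
  have hK : 0 < K := by positivity
  have hlogk : Real.log k < 0 := Real.log_neg hk0 hk1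
  have hlogγ : 0 < Real.log (1 + γ) := Real.log_pos (by linarith)
  set β : ℝ := Real.log (1 + γ) / (-Real.log k) with hβ
  have hβ0 : 0 < β := div_pos hlogγ (by linarith)
  have hkβ : k ^ β * (1 + γ) = 1 := by
    have h1 : k ^ β = Real.exp (-Real.log (1 + γ)) := by
      rw [Real.rpow_def_of_pos hk0]
      congr 1
      have := hlogk.ne
      rw [hβ]
      field_simp
    rw [h1, Real.exp_neg, Real.exp_log (by linarith)]
    exact inv_mul_cancel₀ (by linarith)
  -- Chosen so that `c L^β ≤ K⁻¹` on the starting range `kL ≤ R`.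
  set c : ℝ := K⁻¹ * (R ^ β)⁻¹ * k ^ β with hc
  have hc0 : 0 < c := by positivity
  have base : ∀ E ∈ A, ∀ u, IsSolution V E u → IsNormalized u → ∀ L, R ≤ L → L * k ≤ R →
      c * L ^ β ≤ normSqUpTo u L := by
    intro E hE u hu hn L hL hLk
    have h1 : (L * k) ^ β ≤ R ^ β := by
      have : 0 < L := by linarith
      gcongr
    rw [Real.mul_rpow (by linarith) hk0.le] at h1
    have h2 := ha.le_normSqUpTo_two hE hu hn
    have h3 : K⁻¹ ≤ normSqUpTo u 2 := by rwa [inv_le_iff_one_le_mul₀ hK, mul_comm]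
    have h4 : normSqUpTo u 2 ≤ normSqUpTo u L := normSqUpTo_mono u (by norm_num) (by linarith)
    have hRβ : 0 < R ^ β := by positivity
    calc c * L ^ β = K⁻¹ * ((R ^ β)⁻¹ * (L ^ β * k ^ β)) := by rw [hc]; ring
      _ ≤ K⁻¹ * ((R ^ β)⁻¹ * R ^ β) := by gcongr
      _ = K⁻¹ := by rw [inv_mul_cancel₀ hRβ.ne', mul_one]
      _ ≤ _ := h3.trans h4
  have step : ∀ E ∈ A, ∀ u, IsSolution V E u → IsNormalized u → ∀ m : ℕ, ∀ L, R ≤ L →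
      L * k ≤ R * k⁻¹ ^ m → c * L ^ β ≤ normSqUpTo u L := by
    intro E hE u hu hn m
    induction m with
    | zero => intro L hL hLk; exact base E hE u hu hn L hL (by simpa using hLk)
    | succ m ih =>
      intro L hL hLk
      rcases le_total (L * k) R with h | h
      · exact base E hE u hu hn L hL h
      · have h1 := ih (k * L) (by linarith) (by
          rw [pow_succ, ← mul_assoc, ← div_eq_mul_inv, le_div_iff₀ hk0] at hLk
          linarith)
        have h2 := hb E hE u hu L ((le_max_left _ _).trans hL)
        rw [Real.mul_rpow hk0.le (by linarith)] at h1
        have h3 := mul_le_mul_of_nonneg_left h1 (by linarith : 0 ≤ 1 + γ)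
        calc c * L ^ β = (1 + γ) * (c * (k ^ β * L ^ β)) := by
              linear_combination (-(c * L ^ β)) * hkβ
          _ ≤ _ := h3.trans h2
  refine ⟨√c, β / 2, R, Real.sqrt_pos.2 hc0, by linarith, by linarith, ?_⟩
  intro E hE u hu hn L hL
  obtain ⟨m, hm⟩ := pow_unbounded_of_one_lt L ((one_lt_inv₀ hk0).2 hk1)
  have hL0 : 0 < L := by linarith
  have h1 := step E hE u hu hn m L hL (by nlinarith)
  refine Real.le_sqrt_of_sq_le ?_
  rw [mul_pow, Real.sq_sqrt hc0.le, ← Real.rpow_mul_natCast hL0.le]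
  convert h1 using 3
  push_cast; ring

/-! ### The choice of scale -/

theorem UpperPowerBound.one_le {V : ℤ → ℝ} {A : Set ℝ} {C α : ℝ}
    (ha : UpperPowerBound V A C α) {E : ℝ} (hE : E ∈ A) : 1 ≤ C := by
  have h := ha E hE _ (isSolution_solutionOf V E 0 1) (isNormalized_solutionOf V E (by norm_num))
    1 le_rfl
  simpa [normSqUpTo, solutionOf] using h

theorem LowerPowerBound.le_normSqUpTo {V : ℤ → ℝ} {A : Set ℝ} {D κ L₁ : ℝ} (hD : 0 < D)
    (hc : LowerPowerBound V A D κ L₁) {E : ℝ} (hE : E ∈ A) {u : ℕ → ℝ} (hu : IsSolution V E u)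
    (hn : IsNormalized u) {L : ℝ} (hL0 : 0 < L) (hL : L₁ ≤ L) :
    D ^ 2 * L ^ (2 * κ) ≤ normSqUpTo u L := by
  have h1 := hc E hE u hu hn L hL
  have h2 : (D * L ^ κ) ^ 2 ≤ normSqUpTo u L := by
    rwa [Real.le_sqrt (by positivity) (normSqUpTo_nonneg u hL0.le)] at h1
  rwa [mul_pow, ← Real.rpow_mul_natCast hL0.le, mul_comm κ] at h2

section Scale

variable {V : ℤ → ℝ} {A : Set ℝ} {C α D κ L₁ : ℝ} {E : ℝ}

/-- Intermediate values: at `l` the upper power bound keeps the determinant at most `M²`, while (c)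
eventually pushes it above `M²`. A single `N` serves the whole interval. -/
theorem exists_gramDet_eq (hD : 0 < D) (hκ : 0 < κ)
    (ha : UpperPowerBound V A C α) (hc : LowerPowerBound V A D κ L₁) (hE : E ∈ A)
    {M l : ℝ} (hM : 0 < M) (hl1 : 1 ≤ l) (hl : L₁ ≤ l) (hlM : C * l ^ (2 * α + 1) = M) :
    ∃ L, l ≤ L ∧ ∃ N : ℕ, L ≤ N ∧ gramDet V E N L = M ^ 2 := by
  have hgrow : Tendsto (fun L : ℝ => D ^ 2 * L ^ (2 * κ)) atTop atTop :=
    (tendsto_rpow_atTop (by linarith : 0 < 2 * κ)).const_mul_atTop (by positivity)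
  obtain ⟨Lm, hLm, hLM⟩ := ((eventually_ge_atTop l).and (hgrow.eventually_ge_atTop M)).exists
  obtain ⟨N, hN⟩ := exists_nat_ge Lm
  have hlo : gramDet V E N l ≤ M ^ 2 := by
    have hn1 : ∀ x y : ℝ, x ^ 2 + y ^ 2 = 1 →
        weightedSum N l (fun n => solutionOf V E x y n ^ 2) ≤ M := by
      intro x y hxy
      rw [← normSqUpTo_eq_weightedSum _ (by linarith) (hLm.trans hN), ← hlM]
      exact ha E hE _ (isSolution_solutionOf V E x y) (isNormalized_solutionOf V E hxy) l hl1
    refine (gramDet_le_mul V E 1 0 (by norm_num) N l).trans ?_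
    rw [pow_two]
    exact mul_le_mul (hn1 _ _ (by norm_num)) (hn1 _ _ (by norm_num))
      (weightedSum_nonneg _ _ fun n => sq_nonneg _) hM.le
  have hhi : M ^ 2 ≤ gramDet V E N Lm := by
    refine sq_le_gramDet V E N Lm M hM.le fun x y => ?_
    rw [← normSqUpTo_eq_weightedSum _ (by linarith) hN]
    have := le_normSqUpTo_of_forall_normalized (V := V) (E := E) (B := M) (L := Lm) (by linarith)
      (fun u hu hn => hLM.trans (hc.le_normSqUpTo hD hE hu hn (by linarith) (hl.trans hLm)))
      (isSolution_solutionOf V E x y)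
    simpa [solutionOf] using this
  obtain ⟨L, hL, hLeq⟩ := intermediate_value_Icc hLm (continuous_gramDet V E N).continuousOn
    ⟨hlo, hhi⟩
  exact ⟨L, hL.1, N, hL.2.trans hN, hLeq⟩

theorem solutionOf_initial {u : ℕ → ℝ} (hu : IsSolution V E u) :
    u = solutionOf V E (u 0) (u 1) := by
  funext n
  induction n using Nat.twoStepInduction with
  | zero => simp [solutionOf]
  | one => simp [solutionOf]
  | more n h1 h2 =>
    rw [solutionOf_add_two, ← h1, ← h2]
    have := hu (n + 1) (by omega)
    simp only [Nat.add_sub_cancel] at this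
    push_cast at this
    linear_combination this

theorem UpperPowerBound.le_normSqUpTo_of_gramDet (ha : UpperPowerBound V A C α) (hC : 0 < C)
    (hE : E ∈ A) {L : ℝ} (hL : 1 ≤ L) {N : ℕ} (hN : L ≤ N) {u : ℕ → ℝ} (hu : IsSolution V E u)
    (hn : IsNormalized u) : gramDet V E N L / (C * L ^ (2 * α + 1)) ≤ normSqUpTo u L := by
  have h1 := gramDet_le_mul V E (u 0) (u 1) hn N L
  rw [← solutionOf_initial hu, ← normSqUpTo_eq_weightedSum _ (by linarith) hN,
    ← normSqUpTo_eq_weightedSum _ (by linarith) hN] at h1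
  have h2 := ha E hE _ (isSolution_solutionOf V E (-u 1) (u 0))
    (isNormalized_solutionOf V E (by rw [neg_sq, add_comm]; exact hn)) L hL
  have hL0 : 0 < L := by linarith
  rw [div_le_iff₀ (by positivity)]
  exact h1.trans (mul_le_mul_of_nonneg_left h2 (normSqUpTo_nonneg u hL0.le))

/-! ### Lower bound for sums over an annulus -/

theorem annulus_sum_ge {k γ L B p : ℝ} (hk0 : 0 < k) (hk1 : k < 1) (hγ0 : 0 < γ) (hγ1 : γ < 1)
    (hL : 1 ≤ L) (hp : 0 ≤ p) (hB0 : 0 ≤ B) {N : ℕ} (hN : L ≤ N)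
    (hb : ∀ u, IsSolution V E u → (1 + γ) * normSqUpTo u (k * L) ≤ normSqUpTo u L)
    (hB : ∀ u, IsSolution V E u → IsNormalized u → B ≤ normSqUpTo u L)
    {z : ℂ} {c : ℕ → ℂ} (hc : ∀ n, c (n + 2) = (z - V ((n : ℤ) + 1)) * c (n + 1) - c n)
    (hz : ‖z - E‖ ^ 2 * (2 * gramDet V E N L) ≤ γ ^ 2 / 500) :
    γ / 12 * (k * L) ^ p * B * ‖c 1‖ ^ 2 ≤ ∑ n ∈ Finset.Icc 1 N, (n : ℝ) ^ p * ‖c n‖ ^ 2 := by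
  have hL0 : 0 < L := by linarith
  have hkL : k * L ≤ L := by nlinarith
  have hkL0 : 0 < k * L := by positivity
  set φ : ℕ → ℂ := fun n => c 0 * solutionOf V E 1 0 n + c 1 * solutionOf V E 0 1 n with hφ
  set ur := solutionOf V E (c 0).re (c 1).re with hur
  set ui := solutionOf V E (c 0).im (c 1).im with hui
  have hφsq : ∀ n, ‖φ n‖ ^ 2 = ur n ^ 2 + ui n ^ 2 := by
    intro n
    rw [hur, hui, solutionOf_eq V E (c 0).re, solutionOf_eq V E (c 0).im, ← Complex.normSq_eq_norm_sq,
      Complex.normSq_apply, hφ]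
    simp
    ring
  have hsur := isSolution_solutionOf V E (c 0).re (c 1).re
  have hsui := isSolution_solutionOf V E (c 0).im (c 1).im
  have hnorm : ∀ l : ℝ, 0 ≤ l → l ≤ N →
      weightedSum N l (fun n => ‖φ n‖ ^ 2) = normSqUpTo ur l + normSqUpTo ui l := by
    intro l h0 h1
    rw [normSqUpTo_eq_weightedSum _ h0 h1, normSqUpTo_eq_weightedSum _ h0 h1]
    simp only [hφsq, weightedSum, mul_add, Finset.sum_add_distrib]
  set Φ := weightedSum N L (fun n => ‖φ n‖ ^ 2) with hΦ
  set Φk := weightedSum N (k * L) (fun n => ‖φ n‖ ^ 2) with hΦk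
  set H := weightedSum N L (fun n => ‖c n - φ n‖ ^ 2) with hH
  set G := weightedSum N L (fun n => ‖c n‖ ^ 2) with hG
  have hgap : (1 + γ) * Φk ≤ Φ := by
    rw [hΦ, hΦk, hnorm L hL0.le hN, hnorm (k * L) hkL0.le (hkL.trans hN)]
    linarith [hb ur hsur, hb ui hsui]
  have hΦ0 : 0 ≤ Φ := weightedSum_nonneg _ _ fun n => sq_nonneg _
  have hΦk0 : 0 ≤ Φk := weightedSum_nonneg _ _ fun n => sq_nonneg _
  have hH0 : 0 ≤ H := weightedSum_nonneg _ _ fun n => sq_nonneg _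
  have hG0 : 0 ≤ G := weightedSum_nonneg _ _ fun n => sq_nonneg _
  have hHG : H ≤ γ ^ 2 / 500 * G :=
    (weightedSum_norm_sub_sq_le hc N L).trans (mul_le_mul_of_nonneg_right hz hG0)
  have hsq : ∀ a b : ℂ, ‖a + b‖ ^ 2 ≤ 2 * ‖a‖ ^ 2 + 2 * ‖b‖ ^ 2 := by
    intro a b
    have := norm_add_le a b
    nlinarith [sq_nonneg (‖a‖ - ‖b‖), norm_nonneg (a + b), norm_nonneg a, norm_nonneg b]
  have hGΦ : G ≤ 2 * Φ + 2 * H := by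
    simp only [hG, hΦ, hH, weightedSum, Finset.mul_sum, ← Finset.sum_add_distrib]
    refine Finset.sum_le_sum fun n _ => ?_
    have := mul_le_mul_of_nonneg_left (hsq (φ n) (c n - φ n)) (siteWeight_nonneg L n)
    rw [add_sub_cancel] at this
    linarith
  -- The weight of the annulus: it vanishes for `n ≤ kL` and counts the end sites fractionally.
  set ω : ℕ → ℝ := fun n => siteWeight L n - siteWeight (k * L) n with hω
  have hω0 : ∀ n, 0 ≤ ω n := fun n => sub_nonneg.2 (siteWeight_mono hkL n)
  set S := ∑ n ∈ Finset.Icc 1 N, ω n * ‖c n‖ ^ 2 with hS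
  have hΦS : Φ - Φk ≤ 2 * S + 2 * H := by
    have h1 : Φ - Φk = ∑ n ∈ Finset.Icc 1 N, ω n * ‖φ n‖ ^ 2 := by
      simp only [hΦ, hΦk, hω, weightedSum, sub_mul, Finset.sum_sub_distrib]
    rw [h1]
    simp only [hS, hH, weightedSum, Finset.mul_sum, ← Finset.sum_add_distrib]
    refine Finset.sum_le_sum fun n _ => ?_
    have h2 := mul_le_mul_of_nonneg_left (hsq (c n) (φ n - c n)) (hω0 n)
    rw [add_sub_cancel, norm_sub_rev (φ n)] at h2
    have h3 : ω n * ‖c n - φ n‖ ^ 2 ≤ siteWeight L n * ‖c n - φ n‖ ^ 2 :=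
      mul_le_mul_of_nonneg_right (sub_le_self _ (siteWeight_nonneg _ n)) (sq_nonneg _)
    linarith
  -- `G ≤ 2Φ + 2H` is absorbed into `H ≤ (γ²/500) G`, leaving `H ≤ (γ/200) Φ`; (b) gives `Φ - Φk ≥
  -- γ/(1+γ) Φ ≥ (γ/2) Φ`. The factor `1/12` has room to spare.
  have hSΦ : γ / 12 * Φ ≤ S := by
    have hγ2 : γ ^ 2 ≤ γ := by nlinarith
    have h1 : H ≤ γ / 200 * Φ := by nlinarith
    have h2 : γ / 2 * Φ ≤ Φ - Φk := by nlinarith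
    nlinarith
  have hBΦ : B * ‖c 1‖ ^ 2 ≤ Φ := by
    have h1 := le_normSqUpTo_of_forall_normalized hL0.le hB hsur
    have h2 := le_normSqUpTo_of_forall_normalized hL0.le hB hsui
    rw [hΦ, hnorm L hL0.le hN, ← Complex.normSq_eq_norm_sq, Complex.normSq_apply]
    simp only [solutionOf] at h1 h2
    have h3 := mul_nonneg hB0 (sq_nonneg (c 0).re)
    have h4 := mul_nonneg hB0 (sq_nonneg (c 0).im)
    nlinarith
  have hSsum : (k * L) ^ p * S ≤ ∑ n ∈ Finset.Icc 1 N, (n : ℝ) ^ p * ‖c n‖ ^ 2 := by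
    rw [hS, Finset.mul_sum]
    refine Finset.sum_le_sum fun n _ => ?_
    rcases le_or_gt (n : ℝ) (k * L) with h | h
    · have : ω n = 0 := by
        simp only [hω]
        rw [siteWeight_eq_one h, siteWeight_eq_one (h.trans hkL), sub_self]
      rw [this]
      simp only [zero_mul, mul_zero]
      positivity
    · have h1 : ω n ≤ 1 := (sub_le_self _ (siteWeight_nonneg _ n)).trans (siteWeight_le_one L n)
      have h2 : (k * L) ^ p ≤ (n : ℝ) ^ p := Real.rpow_le_rpow hkL0.le h.le hp
      have h3 : ω n * ‖c n‖ ^ 2 ≤ ‖c n‖ ^ 2 := mul_le_of_le_one_left (sq_nonneg _) h1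
      exact mul_le_mul h2 h3 (mul_nonneg (hω0 n) (sq_nonneg _)) (by positivity)
  refine le_trans ?_ hSsum
  have hpow : 0 ≤ (k * L) ^ p := by positivity
  calc γ / 12 * (k * L) ^ p * B * ‖c 1‖ ^ 2 = (k * L) ^ p * (γ / 12 * (B * ‖c 1‖ ^ 2)) := by ring
    _ ≤ (k * L) ^ p * (γ / 12 * Φ) := by gcongr
    _ ≤ _ := by gcongr

end Scale

/-! ### From pointwise bounds to the averaged moment -/

/-- The Laplace transform of the flow on the sites `0, 1, 2, …`, corrected at `0` so that it solves
the homogeneous difference equation at all sites `n ≥ 1`. -/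
noncomputable def greenSeq {X : Lattice} (ψ : ℝ → Ell2 X) (ε E : ℝ) (n : ℕ) : ℂ :=
  zeroExt (laplaceFlow ψ ε E) n - if n = 0 then 1 else 0

theorem Lattice.natCast_mem_sites (X : Lattice) {n : ℕ} (hn : 1 ≤ n) : (n : ℤ) ∈ X.sites := by
  cases X
  · exact Set.mem_univ _
  · exact Set.mem_Ici.2 (by exact_mod_cast hn)

theorem greenSeq_of_pos {X : Lattice} (ψ : ℝ → Ell2 X) (ε E : ℝ) {n : ℕ} (hn : 1 ≤ n) :
    greenSeq ψ ε E n = laplaceFlow ψ ε E ⟨n, X.natCast_mem_sites hn⟩ := by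
  rw [greenSeq, if_neg (by omega), sub_zero]
  exact zeroExt_coe _ (⟨n, X.natCast_mem_sites hn⟩ : X.sites)

theorem greenSeq_add_two {X : Lattice} {V : ℤ → ℝ} {ψ : ℝ → Ell2 X}
    (h : IsSchrodingerFlow (schrodingerOp X V) (delta X X.one) ψ) {ε : ℝ} (hε : 0 < ε) (E : ℝ)
    (n : ℕ) : greenSeq ψ ε E (n + 2)
      = (E + Complex.I * ε - V ((n : ℤ) + 1)) * greenSeq ψ ε E (n + 1) - greenSeq ψ ε E n := by
  have hd := diffExpr_laplaceFlow h hε E ⟨((n + 1 : ℕ) : ℤ), X.natCast_mem_sites (by omega)⟩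
  rw [diffExpr, ← greenSeq_of_pos ψ ε E (Nat.le_add_left 1 n)] at hd
  simp only [greenSeq] at hd ⊢
  rw [if_neg (by omega)] at hd ⊢
  rw [if_neg (by omega)]
  have e1 : ((n + 1 : ℕ) : ℤ) + 1 = ((n + 2 : ℕ) : ℤ) := by push_cast; ring
  have e2 : ((n + 1 : ℕ) : ℤ) - 1 = (n : ℤ) := by push_cast; ring
  have e3 : (delta X X.one : X.sites → ℂ) ⟨((n + 1 : ℕ) : ℤ), X.natCast_mem_sites (by omega)⟩
      = if n = 0 then 1 else 0 := by
    rw [delta_apply]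
    congr 1
    rw [Subtype.ext_iff, X.coe_one]
    simp
  rw [e1, e2, e3] at hd
  push_cast at hd ⊢
  linear_combination hd

/-- The cutoff `N` may depend on `E` without measurability trouble: each finite sum is at once
bounded by the sum over all sites, whose terms are continuous in `E`. -/
theorem ofReal_mul_imIntegral_le_avgMoment {X : Lattice} {V : ℤ → ℝ} {p T K : ℝ} (hT : 0 < T)
    (hK : 0 ≤ K) {A : Set ℝ} (hA : MeasurableSet A)
    (h : ∀ E ∈ A, ∃ N : ℕ, K * ‖greenSeq (schrodingerEvolution (schrodingerOp X V)
        (delta X X.one)) (1 / T) E 1‖ ^ 2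
      ≤ ∑ n ∈ Finset.Icc 1 N, (n : ℝ) ^ p * ‖greenSeq (schrodingerEvolution (schrodingerOp X V)
        (delta X X.one)) (1 / T) E n‖ ^ 2) :
    ENNReal.ofReal (K / Real.pi) * imIntegral X V A (1 / T) ≤ avgMoment X V p T := by
  have hflow := isSchrodingerFlow_evolution X V
  have hε : 0 < 1 / T := by positivity
  set ψ := schrodingerEvolution (schrodingerOp X V) (delta X X.one) with hψ
  have hpt : ∀ E ∈ A, ENNReal.ofReal K *
      ENNReal.ofReal ((borelTransform X V ((E : ℂ) + Complex.I * ((1 / T : ℝ) : ℂ))).im ^ 2)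
      ≤ ∑' n : X.sites, ENNReal.ofReal (|((n : ℤ) : ℝ)| ^ p) * ‖laplaceFlow ψ (1 / T) E n‖ₑ ^ 2 := by
    intro E hE
    obtain ⟨N, hN⟩ := h E hE
    have hbt : borelTransform X V ((E : ℂ) + Complex.I * ((1 / T : ℝ) : ℂ))
        = greenSeq ψ (1 / T) E 1 := by
      rw [borelTransform_eq_laplaceFlow hflow hε, greenSeq_of_pos _ _ _ le_rfl]
      congr 1
      exact Subtype.ext X.coe_one
    set ι : Finset.Icc 1 N → X.sites :=
      fun n => ⟨((n : ℕ) : ℤ), X.natCast_mem_sites (Finset.mem_Icc.1 n.2).1⟩ with hι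
    have hinj : Function.Injective ι := by
      intro a b hab
      have : ((a : ℕ) : ℤ) = ((b : ℕ) : ℤ) := congrArg (fun x : X.sites => (x : ℤ)) hab
      exact Subtype.ext (by exact_mod_cast this)
    calc ENNReal.ofReal K *
        ENNReal.ofReal ((borelTransform X V ((E : ℂ) + Complex.I * ((1 / T : ℝ) : ℂ))).im ^ 2)
        = ENNReal.ofReal (K * (greenSeq ψ (1 / T) E 1).im ^ 2) := by
          rw [hbt, ENNReal.ofReal_mul hK]
      _ ≤ ENNReal.ofReal (∑ n ∈ Finset.Icc 1 N, (n : ℝ) ^ p * ‖greenSeq ψ (1 / T) E n‖ ^ 2) := by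
          refine ENNReal.ofReal_le_ofReal (le_trans ?_ hN)
          refine mul_le_mul_of_nonneg_left ?_ hK
          rw [← sq_abs]
          gcongr
          exact Complex.abs_im_le_norm _
      _ = ∑ n : Finset.Icc 1 N, ENNReal.ofReal (|(((ι n : X.sites) : ℤ) : ℝ)| ^ p)
            * ‖laplaceFlow ψ (1 / T) E (ι n)‖ₑ ^ 2 := by
          rw [ENNReal.ofReal_sum_of_nonneg (fun n _ => by positivity),
            ← Finset.sum_coe_sort (Finset.Icc 1 N)]
          refine Finset.sum_congr rfl fun n _ => ?_
          rw [ENNReal.ofReal_mul (by positivity), greenSeq_of_pos _ _ _ (Finset.mem_Icc.1 n.2).1,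
            ENNReal.ofReal_pow (norm_nonneg _), ofReal_norm]
          simp [hι]
      _ = ∑' n : Finset.Icc 1 N, ENNReal.ofReal (|(((ι n : X.sites) : ℤ) : ℝ)| ^ p)
            * ‖laplaceFlow ψ (1 / T) E (ι n)‖ₑ ^ 2 := (tsum_fintype _).symm
      _ ≤ _ := ENNReal.tsum_comp_le_tsum_of_injective hinj
          fun n : X.sites => ENNReal.ofReal (|((n : ℤ) : ℝ)| ^ p) * ‖laplaceFlow ψ (1 / T) E n‖ₑ ^ 2
  have hmeas : ∀ n : X.sites, Measurable fun E : ℝ => ‖laplaceFlow ψ (1 / T) E n‖ₑ ^ 2 :=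
    fun n => ((continuous_laplaceFlow hflow hε n).measurable.enorm).pow_const 2
  have hmom : avgMoment X V p T = ENNReal.ofReal (1 / T / Real.pi) *
      ∫⁻ E : ℝ, ∑' n : X.sites, ENNReal.ofReal (|((n : ℤ) : ℝ)| ^ p)
        * ‖laplaceFlow ψ (1 / T) E n‖ₑ ^ 2 := by
    rw [lintegral_tsum fun n => ((hmeas n).const_mul _).aemeasurable, ← ENNReal.tsum_mul_left]
    refine tsum_congr fun n => ?_
    rw [timeAvgProb_eq X V n hT, lintegral_const_mul _ (hmeas n)]
    ring
  rw [hmom, imIntegral, ← mul_assoc, ← ENNReal.ofReal_mul (by positivity)]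
  have hconst : K / Real.pi * (1 / T) = 1 / T / Real.pi * K := by ring
  rw [hconst, ENNReal.ofReal_mul (by positivity), mul_assoc]
  gcongr
  calc _ ≤ ∫⁻ E in A, ENNReal.ofReal K *
      ENNReal.ofReal ((borelTransform X V ((E : ℂ) + Complex.I * ((1 / T : ℝ) : ℂ))).im ^ 2) :=
        (lintegral_const_mul' _ _ ENNReal.ofReal_ne_top).ge
    _ ≤ _ := setLIntegral_mono' hA hpt
    _ ≤ _ := setLIntegral_le_lintegral _ _

/-! ### Optimisation over the scale -/

theorem interpolate_le_max {C D Q L p α κ : ℝ} (hC : 0 < C) (hD : 0 < D) (hQ : 0 < Q)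
    (hL : 0 < L) (hα : 0 < α) (hκ : 0 < κ) (hp : 0 < p) (hpα : p ≤ 2 * α + 1) :
    (Q / C) ^ ((p + 2 * κ) / (2 * α + 1 + 2 * κ))
        * D ^ (2 - 2 * (p + 2 * κ) / (2 * α + 1 + 2 * κ))
      ≤ L ^ p * max (D ^ 2 * L ^ (2 * κ)) (Q / (C * L ^ (2 * α + 1))) := by
  set m := 2 * α + 1 + 2 * κ with hm
  have hm0 : 0 < m := by positivity
  -- `Λ` is the scale at which the two bounds in the maximum coincide.
  set Λ : ℝ := (Q / (C * D ^ 2)) ^ (1 / m) with hΛ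
  have hΛ0 : 0 < Λ := by positivity
  have hΛm : Λ ^ m = Q / (C * D ^ 2) := by
    rw [hΛ, ← Real.rpow_mul (by positivity), one_div_mul_cancel hm0.ne', Real.rpow_one]
  have hlhs : (Q / C) ^ ((p + 2 * κ) / m) * D ^ (2 - 2 * (p + 2 * κ) / m)
      = D ^ 2 * Λ ^ (p + 2 * κ) := by
    have h1 : Q / C = Λ ^ m * D ^ 2 := by rw [hΛm]; field_simp
    rw [h1, Real.mul_rpow (by positivity) (by positivity), ← Real.rpow_mul hΛ0.le,
      mul_div_cancel₀ _ hm0.ne', ← Real.rpow_natCast D 2, ← Real.rpow_mul hD.le, mul_assoc,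
      ← Real.rpow_add hD, mul_comm]
    congr 2
    push_cast
    ring
  rw [hlhs]
  rcases le_total Λ L with h | h
  · calc D ^ 2 * Λ ^ (p + 2 * κ) ≤ D ^ 2 * L ^ (p + 2 * κ) := by gcongr
      _ = L ^ p * (D ^ 2 * L ^ (2 * κ)) := by rw [Real.rpow_add hL]; ring
      _ ≤ _ := by gcongr; exact le_max_left _ _
  · have hQ' : Q = C * D ^ 2 * Λ ^ m := by rw [hΛm]; field_simp
    calc D ^ 2 * Λ ^ (p + 2 * κ)
        = D ^ 2 * Λ ^ m * Λ ^ (p - (2 * α + 1)) := by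
          rw [mul_assoc, ← Real.rpow_add hΛ0, hm]; congr 2; ring
      _ ≤ D ^ 2 * Λ ^ m * L ^ (p - (2 * α + 1)) := by
          gcongr ?_ * ?_
          exact Real.rpow_le_rpow_of_nonpos hL h (by linarith)
      _ = L ^ p * (Q / (C * L ^ (2 * α + 1))) := by
          rw [hQ', Real.rpow_sub hL]; field_simp
      _ ≤ _ := by gcongr; exact le_max_right _ _

theorem norm_sub_sq_le_of_dist_lt {E E₀ ε : ℝ} (h : dist E E₀ < 2 * ε) :
    ‖(E + Complex.I * ε : ℂ) - E₀‖ ^ 2 ≤ 5 * ε ^ 2 := by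
  rw [Real.dist_eq] at h
  have h1 : (E - E₀) ^ 2 ≤ (2 * ε) ^ 2 := by
    rw [← sq_abs]; gcongr
  rw [← Complex.normSq_eq_norm_sq, Complex.normSq_apply]
  simp
  nlinarith

/-- At every energy near `A` the Green sequence is large on an annulus whose radius is at least
`(γT/(72C))^{1/(2α+1)}`. -/
theorem exists_scale_sum_ge {X : Lattice} {V : ℤ → ℝ} {A : Set ℝ} {C α k γ L₀ D κ L₁ T l : ℝ}
    (hC : 0 < C) (hk0 : 0 < k) (hk1 : k < 1) (hγ0 : 0 < γ) (hγ1 : γ < 1)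
    (ha : UpperPowerBound V A C α) (hb : ScalingLowerBound V A k γ L₀)
    (hD : 0 < D) (hκ : 0 < κ) (hc : LowerPowerBound V A D κ L₁)
    (hT : 0 < T) (hl1 : 1 ≤ l) (hl0 : L₀ ≤ l) (hlL : L₁ ≤ l)
    (hl : C * l ^ (2 * α + 1) = γ * T / 72)
    {ψ : ℝ → Ell2 X} (hψ : IsSchrodingerFlow (schrodingerOp X V) (delta X X.one) ψ)
    {E : ℝ} (hE : E ∈ Metric.thickening (2 * (1 / T)) A) :
    ∃ L, l ≤ L ∧ ∃ N : ℕ, ∀ p : ℝ, 0 ≤ p →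
      γ / 12 * (k * L) ^ p * max (D ^ 2 * L ^ (2 * κ))
          ((γ * T / 72) ^ 2 / (C * L ^ (2 * α + 1))) * ‖greenSeq ψ (1 / T) E 1‖ ^ 2
        ≤ ∑ n ∈ Finset.Icc 1 N, (n : ℝ) ^ p * ‖greenSeq ψ (1 / T) E n‖ ^ 2 := by
  obtain ⟨E₀, hE₀, hdist⟩ := Metric.mem_thickening_iff.1 hE
  obtain ⟨L, hlL', N, hN, hdet⟩ := exists_gramDet_eq hD hκ ha hc hE₀
    (M := γ * T / 72) (by positivity) hl1 hlL hl
  have hL1 : 1 ≤ L := hl1.trans hlL'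
  have hL0 : 0 < L := by linarith
  refine ⟨L, hlL', N, fun p hp => annulus_sum_ge (V := V) (E := E₀)
    (B := max (D ^ 2 * L ^ (2 * κ)) ((γ * T / 72) ^ 2 / (C * L ^ (2 * α + 1)))) (p := p) hk0 hk1 hγ0 hγ1 hL1 hp
    (le_max_of_le_left (by positivity)) hN (fun u hu => hb E₀ hE₀ u hu L (hl0.trans hlL')) (fun u hu hn => max_le ?_ ?_)
    (greenSeq_add_two (ε := 1 / T) hψ (by positivity) E) ?_⟩
  · exact hc.le_normSqUpTo hD hE₀ hu hn hL0 (hlL.trans hlL')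
  · rw [← hdet]
    exact ha.le_normSqUpTo_of_gramDet hC hE₀ hL1 hN hu hn
  · rw [hdet]
    -- Here `72² = 5184`, and `10/5184 < 1/500` is the smallness that `annulus_sum_ge` requires.
    calc _ ≤ 5 * (1 / T) ^ 2 * (2 * (γ * T / 72) ^ 2) :=
          mul_le_mul_of_nonneg_right (norm_sub_sq_le_of_dist_lt hdist) (by positivity)
      _ = 10 / 5184 * γ ^ 2 := by field_simp; ring
      _ ≤ _ := by nlinarith [sq_nonneg γ]

end Schrodinger1D

theorem theorem1 (X : Lattice) (V : ℤ → ℝ) (A : Set ℝ) (C α k γ L₀ : ℝ)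
    (hC : 0 < C) (hα : 0 < α) (hk0 : 0 < k) (hk1 : k < 1) (hγ0 : 0 < γ) (hγ1 : γ < 1)
    (hL₀ : 1 ≤ L₀)
    (ha : UpperPowerBound V A C α) (hb : ScalingLowerBound V A k γ L₀) :
    (∃ D κ L₁ : ℝ, 0 < D ∧ 0 < κ ∧ 1 ≤ L₁ ∧ LowerPowerBound V A D κ L₁) ∧
    ∀ D κ L₁ : ℝ, 0 < D → 0 < κ → 1 ≤ L₁ → LowerPowerBound V A D κ L₁ →
      ∃ T₀ : ℝ, 0 < T₀ ∧ ∀ T : ℝ, T₀ ≤ T → ∀ p : ℝ, 0 < p →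
        (p ≤ 2 * α + 1 →
          ENNReal.ofReal (γ * k ^ p / (12 * Real.pi) *
                (γ ^ 2 / (5184 * C)) ^ ((p + 2 * κ) / (2 * α + 1 + 2 * κ)) *
                D ^ (2 - 2 * (p + 2 * κ) / (2 * α + 1 + 2 * κ)) *
                T ^ (2 * (p + 2 * κ) / (2 * α + 1 + 2 * κ))) *
              imIntegral X V (Metric.thickening (2 * (1 / T)) A) (1 / T)
            ≤ avgMoment X V p T) ∧
        (2 * α + 1 < p →
          ENNReal.ofReal (γ * k ^ (2 * α + 1) / (12 * Real.pi) * (γ ^ 2 / (5184 * C)) * T ^ 2) *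
              imIntegral X V (Metric.thickening (2 * (1 / T)) A) (1 / T)
            ≤ avgMoment X V p T ∧
          ENNReal.ofReal (γ * k ^ p / (12 * Real.pi) *
                (γ ^ 2 / (5184 * C ^ 2)) ^ ((p + 2 * κ) / 2) * D ^ 2 *
                T ^ ((p + 2 * κ) / (2 * α + 1))) *
              imIntegral X V (Metric.thickening (2 * (1 / T)) A) (1 / T)
            ≤ avgMoment X V p T) := by
  refine ⟨exists_lowerPowerBound hC hk0 hk1 hγ0 ha hb, ?_⟩
  intro D κ L₁ hD hκ hL₁ hc
  have hα1 : 0 < 2 * α + 1 := by linarith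
  set r : ℝ := max L₀ L₁ with hr
  have hr1 : 1 ≤ r := hL₀.trans (le_max_left _ _)
  have hr0 : 0 < r := by linarith
  -- This threshold makes `l ≥ max L₀ L₁`, so (b) and (c) apply at every scale `L ≥ l`; it does not
  -- depend on `p`.
  refine ⟨72 * C / γ * r ^ (2 * α + 1), by positivity, fun T hT₀ p hp => ?_⟩
  have hT : 0 < T := lt_of_lt_of_le (by positivity) hT₀
  have hpi := Real.pi_pos
  set l : ℝ := (γ * T / (72 * C)) ^ (1 / (2 * α + 1)) with hl
  have hlpow : l ^ (2 * α + 1) = γ * T / (72 * C) := by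
    rw [hl, ← Real.rpow_mul (by positivity), one_div_mul_cancel hα1.ne', Real.rpow_one]
  have hrl : r ≤ l := by
    rw [← Real.rpow_le_rpow_iff hr0.le (by positivity) hα1, hlpow, le_div_iff₀ (by positivity)]
    have := mul_le_mul_of_nonneg_left hT₀ hγ0.le
    refine le_trans (le_of_eq ?_) this
    field_simp
  have hl0 : 0 < l := by linarith
  have hscale := fun {E : ℝ} (hE : E ∈ Metric.thickening (2 * (1 / T)) A) =>
    exists_scale_sum_ge (X := X) hC hk0 hk1 hγ0 hγ1 ha hb hD hκ hc hT (hr1.trans hrl)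
      ((le_max_left _ _).trans hrl) ((le_max_right _ _).trans hrl)
      (by rw [hlpow]; field_simp) (isSchrodingerFlow_evolution X V) hE
  have hQ : (γ * T / 72) ^ 2 / C = γ ^ 2 / (5184 * C) * T ^ 2 := by field_simp; ring
  have hkL : ∀ (q : ℝ) {L m : ℝ}, 0 < L →
      γ / 12 * (k * L) ^ q * m = γ / 12 * k ^ q * (L ^ q * m) := fun q L m hL => by
    rw [Real.mul_rpow hk0.le hL.le]; ring
  have hmeas : MeasurableSet (Metric.thickening (2 * (1 / T)) A) :=
    Metric.isOpen_thickening.measurableSet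
  refine ⟨fun hpα => ?_, fun hpα => ⟨?_, ?_⟩⟩
  · have hconst : γ * k ^ p / (12 * Real.pi) *
          (γ ^ 2 / (5184 * C)) ^ ((p + 2 * κ) / (2 * α + 1 + 2 * κ)) *
          D ^ (2 - 2 * (p + 2 * κ) / (2 * α + 1 + 2 * κ)) *
          T ^ (2 * (p + 2 * κ) / (2 * α + 1 + 2 * κ))
        = γ / 12 * k ^ p * (((γ * T / 72) ^ 2 / C) ^ ((p + 2 * κ) / (2 * α + 1 + 2 * κ))
          * D ^ (2 - 2 * (p + 2 * κ) / (2 * α + 1 + 2 * κ))) / Real.pi := by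
      rw [hQ, Real.mul_rpow (by positivity) (by positivity), ← Real.rpow_natCast T 2,
        ← Real.rpow_mul hT.le]
      push_cast
      rw [mul_div_assoc 2 (p + 2 * κ)]
      field_simp
    rw [hconst]
    refine ofReal_mul_imIntegral_le_avgMoment hT (by positivity) hmeas fun E hE => ?_
    obtain ⟨L, hlL, N, h⟩ := hscale hE
    have hL0 : 0 < L := hl0.trans_le hlL
    refine ⟨N, le_trans (mul_le_mul_of_nonneg_right ?_ (sq_nonneg _)) (h p hp.le)⟩
    rw [hkL p hL0]
    exact mul_le_mul_of_nonneg_left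
      (interpolate_le_max (Q := (γ * T / 72) ^ 2) hC hD (by positivity) hL0 hα hκ hp hpα) (by positivity)
  · have hconst : γ * k ^ (2 * α + 1) / (12 * Real.pi) * (γ ^ 2 / (5184 * C)) * T ^ 2
        = γ / 12 * k ^ (2 * α + 1) * ((γ * T / 72) ^ 2 / C) / Real.pi := by
      rw [hQ]; field_simp
    rw [hconst]
    refine ofReal_mul_imIntegral_le_avgMoment hT (by positivity) hmeas fun E hE => ?_
    obtain ⟨L, hlL, N, h⟩ := hscale hE
    have hL0 : 0 < L := hl0.trans_le hlL
    -- On sites `n ≥ 1` the exponent `p` may be lowered to `2α + 1`, at which the powers of `L`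
    -- cancel exactly against the second bound.
    refine ⟨N, le_trans (mul_le_mul_of_nonneg_right ?_ (sq_nonneg _))
      ((h (2 * α + 1) hα1.le).trans (Finset.sum_le_sum fun n hn => ?_))⟩
    · rw [hkL (2 * α + 1) hL0]
      refine mul_le_mul_of_nonneg_left ?_ (by positivity)
      calc (γ * T / 72) ^ 2 / C
          = L ^ (2 * α + 1) * ((γ * T / 72) ^ 2 / (C * L ^ (2 * α + 1))) := by field_simp
        _ ≤ _ := by gcongr; exact le_max_right _ _
    · have : (1 : ℝ) ≤ n := by exact_mod_cast (Finset.mem_Icc.1 hn).1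
      gcongr
  · have hconst : γ * k ^ p / (12 * Real.pi) *
          (γ ^ 2 / (5184 * C ^ 2)) ^ ((p + 2 * κ) / 2) * D ^ 2 *
          T ^ ((p + 2 * κ) / (2 * α + 1))
        = γ / 12 * k ^ p * ((γ / (72 * C)) ^ (p + 2 * κ) * D ^ 2 *
          T ^ ((p + 2 * κ) / (2 * α + 1))) / Real.pi := by
      have : γ ^ 2 / (5184 * C ^ 2) = (γ / (72 * C)) ^ (2 : ℝ) := by
        rw [Real.rpow_two, div_pow, mul_pow]; norm_num
      rw [this, ← Real.rpow_mul (by positivity), mul_div_cancel₀ _ two_ne_zero]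
      field_simp
    rw [hconst]
    refine ofReal_mul_imIntegral_le_avgMoment hT (by positivity) hmeas fun E hE => ?_
    obtain ⟨E₀, hE₀, -⟩ := Metric.mem_thickening_iff.1 hE
    have hC1 : 1 ≤ C := ha.one_le hE₀
    obtain ⟨L, hlL, N, h⟩ := hscale hE
    have hL0 : 0 < L := hl0.trans_le hlL
    refine ⟨N, le_trans (mul_le_mul_of_nonneg_right ?_ (sq_nonneg _)) (h p hp.le)⟩
    rw [hkL p hL0]
    refine mul_le_mul_of_nonneg_left ?_ (by positivity)
    -- The scale `l` yields the exponent `(p + 2κ)/(2α + 1)` on this base. Because the base is at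
    -- most `1` (as `C ≥ 1` once `A` is nonempty), the larger exponent `p + 2κ` of the statement
    -- only weakens the bound.
    have hbase : γ / (72 * C) ≤ 1 := by
      rw [div_le_one (by positivity)]; linarith
    have hexp : (p + 2 * κ) / (2 * α + 1) ≤ p + 2 * κ := div_le_self (by positivity) (by linarith)
    calc (γ / (72 * C)) ^ (p + 2 * κ) * D ^ 2 * T ^ ((p + 2 * κ) / (2 * α + 1))
        ≤ (γ / (72 * C)) ^ ((p + 2 * κ) / (2 * α + 1)) * D ^ 2
          * T ^ ((p + 2 * κ) / (2 * α + 1)) := by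
          have := Real.rpow_le_rpow_of_exponent_ge (x := γ / (72 * C)) (by positivity) hbase hexp
          gcongr
      _ = D ^ 2 * l ^ (p + 2 * κ) := by
          rw [hl, ← Real.rpow_mul (by positivity), one_div_mul_eq_div, mul_right_comm,
            ← Real.mul_rpow (by positivity) hT.le, mul_comm (D ^ 2), div_mul_eq_mul_div]
      _ ≤ D ^ 2 * L ^ (p + 2 * κ) := by gcongr
      _ = L ^ p * (D ^ 2 * L ^ (2 * κ)) := by rw [Real.rpow_add hL0]; ring
      _ ≤ _ := by gcongr; exact le_max_left _ _
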